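/- Let $(R,\mathfrak{m},k)$ be a commutative Noetherian local ring of dimension $d$ that is Cohen-Macaulay and has minimal multiplicity, i.e. $e(R)=\mu(\mathfrak{m})-d+1$, where $\mu(\mathfrak{m})$ is the minimal number of generators of $\mathfrak{m}$ and $e(R)$ is the multiplicity of $R$ ($d!$ times the leading coefficient of the polynomial $P$ with $P(n)=\lambda_R(R/\mathfrak{m}^{n+1})$ for all $n\gg 0$, where $\lambda_R$ denotes length). For $n\ge 0$ let $\Omega_n^R(k)$ be the $n$th syzygy module of $k$, i.e. the image of the $n$th differential of an augmented minimal free resolution $\cdots\to F_1\to F_0\to k\to 0$ of $k$; the $0$th differential is $F_0\to k$, so $\Omega_0^R(k)=k$. Suppose that there is a surjective $R$-linear map $$\bigoplus_{i=1}^{r}\Omega_{n_i}^R(k)\longrightarrow L$$ from a finite direct sum of syzygy modules of $k$ (with $r\ge 0$ and $n_1,\dots,n_r\ge 0$, repetitions allowed) onto a non-zero $R$-module $L$ of G-dimension zero, i.e. such that, with $(-)^*=\operatorname{Hom}_R(-,R)$, the natural map $L\to L^{**}$ is an isomorphism and $\operatorname{Ext}_R^i(L,R)=0=\operatorname{Ext}_R^i(L^*,R)$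 for all $i\ge 1$. Then $R$ is Gorenstein, i.e. $R$ has finite injective dimension as a module over itself. -/

import Mathlib

open CategoryTheory CategoryTheory.Abelian IsLocalRing

universe u

/-- The depth of a local ring `R`: the supremum of the lengths of `R`-regular sequences
contained in the maximal ideal. -/
noncomputable def localRingDepth (R : Type u) [CommRing R] [IsLocalRing R] : ℕ∞ :=
  ⨆ rs : {rs : List R // (∀ r ∈ rs, r ∈ maximalIdeal R) ∧ RingTheory.Sequence.IsRegular R rs},
    (rs.1.length : ℕ∞)

/-- A Noetherian local ring is Cohen-Macaulay if its depth equals its Krull dimension. -/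
def IsCohenMacaulayLocal (R : Type u) [CommRing R] [IsLocalRing R] [IsNoetherianRing R] : Prop :=
  (localRingDepth R : WithBot ℕ∞) = ringKrullDim R

/-- A Noetherian local ring is Gorenstein if it has finite injective dimension as a module
over itself. -/
def IsGorensteinLocal (R : Type u) [CommRing R] [IsLocalRing R] [IsNoetherianRing R] : Prop :=
  ∃ n : ℕ, HasInjectiveDimensionLE (ModuleCat.of R R) n

/-- `P` is the Hilbert-Samuel polynomial of the local ring `R`: `P(n)` is the length of
`R / 𝔪 ^ (n + 1)` for all `n ≫ 0`. (These lengths are finite because `R` is Noetherian, and there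
is exactly one such polynomial.) -/
def IsHilbertSamuelPolynomial (R : Type u) [CommRing R] [IsLocalRing R] [IsNoetherianRing R]
    (P : Polynomial ℚ) : Prop :=
  ∀ᶠ n : ℕ in Filter.atTop,
    P.eval (n : ℚ) = ((Module.length R (R ⧸ maximalIdeal R ^ (n + 1))).toNat : ℚ)

/-- `e` is the multiplicity of the local ring `R`: if `d = dim R`, then `e` is `d !` times the
leading coefficient of the Hilbert-Samuel polynomial of `R`. -/
def IsMultiplicity (R : Type u) [CommRing R] [IsLocalRing R] [IsNoetherianRing R] (e : ℚ) : Prop :=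
  ∃ (d : ℕ) (P : Polynomial ℚ), ringKrullDim R = d ∧ IsHilbertSamuelPolynomial R P ∧
    e = (d.factorial : ℚ) * P.leadingCoeff

/-- `R` has minimal multiplicity: `e(R) = μ(𝔪) - dim R + 1`, where `μ(𝔪)` is the minimal number
of generators of the maximal ideal. -/
def HasMinimalMultiplicity (R : Type u) [CommRing R] [IsLocalRing R] [IsNoetherianRing R] : Prop :=
  ∃ d : ℕ, ringKrullDim R = d ∧
    IsMultiplicity R (((maximalIdeal R).spanFinrank : ℚ) - d + 1)

/-- An augmented minimal free resolution
`⋯ ⟶ R ^ β₂ ⟶ R ^ β₁ ⟶ R ^ β₀ ⟶ M ⟶ 0`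
of a module `M` over the local ring `R`: an exact complex whose differentials between the free
modules have image in `𝔪` times their target. -/
structure MinimalFreeResolution (R : Type u) [CommRing R] [IsLocalRing R]
    (M : Type u) [AddCommGroup M] [Module R M] where
  /-- the ranks of the free modules -/
  rank : ℕ → ℕ
  /-- the augmentation `R ^ β₀ ⟶ M` -/
  aug : (Fin (rank 0) → R) →ₗ[R] M
  /-- the differential `R ^ βₙ₊₁ ⟶ R ^ βₙ` -/
  diff : ∀ n : ℕ, (Fin (rank (n + 1)) → R) →ₗ[R] (Fin (rank n) → R)
  aug_surjective : Function.Surjective aug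
  exact_zero : Function.Exact (diff 0) aug
  exact_succ : ∀ n : ℕ, Function.Exact (diff (n + 1)) (diff n)
  minimal : ∀ n : ℕ, LinearMap.range (diff n) ≤
    maximalIdeal R • (⊤ : Submodule R (Fin (rank n) → R))

/-- The `n`-th syzygy module `Ωₙ(M)` computed from a minimal free resolution of `M`: the image of
the `n`-th map in the augmented resolution, where the `0`-th map is the augmentation (so that
`Ω₀(M)` is `M`) and the `(n + 1)`-st map is `R ^ βₙ₊₁ ⟶ R ^ βₙ`. -/
noncomputable def MinimalFreeResolution.syzygy {R : Type u} [CommRing R] [IsLocalRing R]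
    {M : Type u} [AddCommGroup M] [Module R M] (F : MinimalFreeResolution R M) :
    ℕ → ModuleCat.{u} R
  | 0 => ModuleCat.of R (LinearMap.range F.aug)
  | n + 1 => ModuleCat.of R (LinearMap.range (F.diff n))

/-- The module `M` has G-dimension zero: the natural map `M ⟶ M**` is an isomorphism, and
`Extⁱ(M, R) = 0 = Extⁱ(M*, R)` for all `i ≥ 1`, where `(-)* = Hom(-, R)`. -/
structure IsGDimZero (R : Type u) [CommRing R] (M : Type u) [AddCommGroup M] [Module R M] :
    Prop where
  bijective_eval : Function.Bijective (Module.Dual.eval R M)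
  ext_eq_zero : ∀ i : ℕ, 1 ≤ i →
    Subsingleton (Ext.{u} (ModuleCat.of R M) (ModuleCat.of R R) i)
  ext_dual_eq_zero : ∀ i : ℕ, 1 ≤ i →
    Subsingleton (Ext.{u} (ModuleCat.of R (Module.Dual R M)) (ModuleCat.of R R) i)

/-! Over the Nagata ring `R(X)`, the localization of `R[X]` at `𝔪R[X]`, the maximal ideal has
superficial elements whatever the residue field is: by Dedekind–Mertens, a polynomial whose
coefficients generate an ideal behaves like a generic element of it. Dividing out `d` of them, which
form a regular sequence, gives an Artinian ring `B` of length `e(R)` whose maximal ideal `𝔫` needs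
`μ(𝔪) - d` generators. Minimal multiplicity makes this number equal to the length `e(R) - 1` of `𝔫`,
so `𝔫 ^ 2 = 0`.

The matrices of the minimal resolution of `k`, of its dual and of a resolution of `L` are carried
along this reduction. The image in `L` of some syzygy of `k` is not contained in `𝔪L`, and over `B`
this, with `Extⁱ(L, R) = 0`, makes every functional on `𝔫` multiplication by an element of `B`.
Since `𝔫 ^ 2 = 0`, the dual of the resolution of `k` is then exact over `B`. Exactness in degrees
above `d` lifts back along the regular sequence to `R`, that is, `Extⁱ(k, R) = 0` for `i > d`, and
dévissage along prime filtrations bounds the injective dimension of `R`. -/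

section ContentIdeal

open Polynomial Filter

variable {A : Type*} [CommRing A]

theorem sup_pow_succ_le (I J : Ideal A) (m : ℕ) :
    (I ⊔ J) ^ (m + 1) ≤ I ^ (m + 1) ⊔ J * (I ⊔ J) ^ m := by
  induction m with
  | zero => simp
  | succ m ih =>
    calc (I ⊔ J) ^ (m + 2)
        = I * (I ⊔ J) ^ (m + 1) ⊔ J * (I ⊔ J) ^ (m + 1) := by
          rw [pow_succ' (I ⊔ J) (m + 1), Ideal.sup_mul]
      _ ≤ I * (I ^ (m + 1) ⊔ J * (I ⊔ J) ^ m) ⊔ J * (I ⊔ J) ^ (m + 1) := by gcongr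
      _ ≤ I ^ (m + 2) ⊔ J * (I ⊔ J) ^ (m + 1) := by
          rw [Ideal.mul_sup, ← pow_succ', sup_assoc, mul_left_comm]
          gcongr
          refine sup_le (Ideal.mul_mono_right ?_) le_rfl
          rw [pow_succ']
          gcongr
          exact le_sup_left

theorem contentIdeal_le_iff {p : A[X]} {I : Ideal A} :
    p.contentIdeal ≤ I ↔ ∀ i, p.coeff i ∈ I := by
  refine ⟨fun h i => h (p.coeff_mem_contentIdeal i), fun h => ?_⟩
  rw [contentIdeal_def, Ideal.span_le]
  intro a ha
  obtain ⟨i, -, rfl⟩ := mem_coeffs_iff.mp ha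
  exact h i

theorem contentIdeal_add_le (p q : A[X]) :
    (p + q).contentIdeal ≤ p.contentIdeal ⊔ q.contentIdeal :=
  contentIdeal_le_iff.mpr fun i => by
    rw [coeff_add]
    exact Submodule.add_mem_sup (p.coeff_mem_contentIdeal i) (q.coeff_mem_contentIdeal i)

theorem contentIdeal_C_mul (a : A) (p : A[X]) :
    (C a * p).contentIdeal = Ideal.span {a} * p.contentIdeal := by
  refine le_antisymm (by simpa using (C a).contentIdeal_mul_le_mul_contentIdeal p) ?_
  rw [Ideal.span_singleton_mul_le_iff]
  have h : p.contentIdeal ≤ Submodule.comap (LinearMap.mulLeft A a) (C a * p).contentIdeal :=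
    contentIdeal_le_iff.mpr fun i => by simpa using (C a * p).coeff_mem_contentIdeal i
  exact h

theorem contentIdeal_eraseLead_sup (p : A[X]) :
    p.eraseLead.contentIdeal ⊔ Ideal.span {p.leadingCoeff} = p.contentIdeal := by
  refine le_antisymm (sup_le (contentIdeal_le_iff.mpr fun i => ?_) ?_) ?_
  · rw [eraseLead_coeff]
    split_ifs
    exacts [zero_mem _, coeff_mem_contentIdeal _ _]
  · exact (Ideal.span_singleton_le_iff_mem _).mpr (coeff_mem_contentIdeal _ _)
  · simpa only [eraseLead_add_monomial_natDegree_leadingCoeff, contentIdeal_monomial] using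
      contentIdeal_add_le p.eraseLead (monomial p.natDegree p.leadingCoeff)

theorem span_leadingCoeff_mul_contentIdeal_le {p z : A[X]} {m : ℕ}
    (ih : ∀ w : A[X], w.natDegree ≤ m →
      p.contentIdeal ^ (m + 1) * w.contentIdeal ≤ p.contentIdeal ^ m * (p * w).contentIdeal)
    (hz : z.natDegree ≤ m + 1) :
    Ideal.span {p.leadingCoeff} * (p.contentIdeal ^ (m + 1) * z.contentIdeal) ≤
      p.contentIdeal ^ (m + 1) * (p * z).contentIdeal := by
  set a := p.leadingCoeff with ha
  set b := z.coeff (m + 1) with hb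
  set w := C a * z.erase (m + 1)
  have hzsplit : z = monomial (m + 1) b + z.erase (m + 1) := (z.monomial_add_erase _).symm
  have hab : a * b ∈ (p * z).contentIdeal := by
    rw [ha, hb, leadingCoeff, ← coeff_mul_add_eq_of_natDegree_le le_rfl hz]
    exact coeff_mem_contentIdeal _ _
  have hwdeg : w.natDegree ≤ m := by
    refine (natDegree_C_mul_le _ _).trans (natDegree_le_iff_coeff_eq_zero.mpr fun i hi => ?_)
    rw [coeff_erase]
    split_ifs with h
    · rfl
    · exact coeff_eq_zero_of_natDegree_lt (by omega)
  have hpw : (p * w).contentIdeal ≤ p.contentIdeal * (p * z).contentIdeal := by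
    have h : p * w = C a * (p * z) + C (a * b) * (p * -X ^ (m + 1)) := by
      conv_rhs => rw [hzsplit, ← C_mul_X_pow_eq_monomial]
      rw [C_mul]
      ring
    rw [h]
    refine (contentIdeal_add_le _ _).trans (sup_le ?_ ?_)
    · rw [contentIdeal_C_mul]
      gcongr
      exact (Ideal.span_singleton_le_iff_mem _).mpr (coeff_mem_contentIdeal _ _)
    · rw [contentIdeal_C_mul, mul_comm p.contentIdeal]
      gcongr
      · exact (Ideal.span_singleton_le_iff_mem _).mpr hab
      · exact (p.contentIdeal_mul_le_mul_contentIdeal _).trans Ideal.mul_le_left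
  have haz : Ideal.span {a} * z.contentIdeal ≤ w.contentIdeal ⊔ (p * z).contentIdeal := by
    rw [← contentIdeal_C_mul, hzsplit, mul_add, C_mul_monomial, ← hzsplit]
    refine (contentIdeal_add_le _ _).trans (sup_le (le_sup_of_le_right ?_) le_sup_left)
    simpa using hab
  calc Ideal.span {a} * (p.contentIdeal ^ (m + 1) * z.contentIdeal)
      = p.contentIdeal ^ (m + 1) * (Ideal.span {a} * z.contentIdeal) := mul_left_comm _ _ _
    _ ≤ p.contentIdeal ^ (m + 1) * (w.contentIdeal ⊔ (p * z).contentIdeal) := by gcongr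
    _ ≤ p.contentIdeal ^ (m + 1) * (p * z).contentIdeal := by
        rw [Ideal.mul_sup]
        refine sup_le ((ih w hwdeg).trans ?_) le_rfl
        rw [pow_succ, mul_assoc]
        gcongr

theorem contentIdeal_pow_mul_le_of_eraseLead {p z : A[X]} {m : ℕ}
    (hlead : Ideal.span {p.leadingCoeff} * (p.contentIdeal ^ m * z.contentIdeal) ≤
      p.contentIdeal ^ m * (p * z).contentIdeal)
    (herase : p.eraseLead.contentIdeal ^ (m + 1) * z.contentIdeal ≤
      p.eraseLead.contentIdeal ^ m * (p.eraseLead * z).contentIdeal) :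
    p.contentIdeal ^ (m + 1) * z.contentIdeal ≤ p.contentIdeal ^ m * (p * z).contentIdeal := by
  set I := p.contentIdeal
  set a := p.leadingCoeff
  set q := p.eraseLead
  have hI : q.contentIdeal ⊔ Ideal.span {a} = I := contentIdeal_eraseLead_sup p
  have hqI : q.contentIdeal ≤ I := hI ▸ le_sup_left
  have hqz : (q * z).contentIdeal ≤ (p * z).contentIdeal ⊔ Ideal.span {a} * z.contentIdeal := by
    have h : q * z = p * z + C a * (-X ^ p.natDegree * z) := by
      linear_combination z * eraseLead_add_C_mul_X_pow p
    rw [h]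
    refine (contentIdeal_add_le _ _).trans (sup_le_sup_left ?_ _)
    rw [contentIdeal_C_mul]
    gcongr
    exact (contentIdeal_mul_le_mul_contentIdeal _ _).trans Ideal.mul_le_right
  calc I ^ (m + 1) * z.contentIdeal
      ≤ (q.contentIdeal ^ (m + 1) ⊔ Ideal.span {a} * I ^ m) * z.contentIdeal := by
        gcongr
        simpa only [hI] using sup_pow_succ_le q.contentIdeal (Ideal.span {a}) m
    _ = q.contentIdeal ^ (m + 1) * z.contentIdeal ⊔
          Ideal.span {a} * (I ^ m * z.contentIdeal) := by
        rw [Ideal.sup_mul, mul_assoc]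
    _ ≤ I ^ m * ((p * z).contentIdeal ⊔ Ideal.span {a} * z.contentIdeal) := by
        refine sup_le (herase.trans (by gcongr)) (hlead.trans ?_)
        gcongr
        exact le_sup_left
    _ ≤ I ^ m * (p * z).contentIdeal := by
        rw [Ideal.mul_sup, mul_left_comm]
        exact sup_le le_rfl hlead

/-- Dedekind–Mertens. -/
theorem contentIdeal_pow_mul_contentIdeal_le {m : ℕ} (p : A[X]) {z : A[X]}
    (hz : z.natDegree ≤ m) :
    p.contentIdeal ^ (m + 1) * z.contentIdeal ≤ p.contentIdeal ^ m * (p * z).contentIdeal := by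
  induction m generalizing p z with
  | zero =>
    obtain ⟨b, rfl⟩ := natDegree_eq_zero.mp (Nat.le_zero.mp hz)
    rw [mul_comm p, contentIdeal_C_mul, contentIdeal_C, mul_comm]
    simp
  | succ m ihm =>
    induction hn : p.support.card using Nat.strong_induction_on generalizing p with
    | _ n ihn =>
    rcases eq_or_ne p 0 with rfl | hp
    · simp
    · exact contentIdeal_pow_mul_le_of_eraseLead
        (span_leadingCoeff_mul_contentIdeal_le (fun w => ihm p) hz)
        (ihn _ (hn ▸ eraseLead_support_card_lt hp) p.eraseLead rfl)

theorem mem_smul_top_pi_iff {ι : Type*} [Finite ι] {I : Ideal A} {u : ι → A} :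
    u ∈ I • (⊤ : Submodule A (ι → A)) ↔ ∀ i, u i ∈ I := by
  have := Fintype.ofFinite ι
  refine ⟨fun hu i => ?_, fun hu => ?_⟩
  · have h : I • (⊤ : Submodule A (ι → A)) ≤ Submodule.comap (LinearMap.proj i) I :=
      Submodule.smul_le.mpr fun a ha v _ => I.mul_mem_right _ ha
    exact h hu
  · classical
    rw [pi_eq_sum_univ' u]
    exact Submodule.sum_mem _ fun i _ => Submodule.smul_mem_smul (hu i) trivial

theorem eventually_colon_pow_succ_le [IsNoetherianRing A] {I : Ideal A}
    (hI : I.annihilator = ⊥) : ∀ᶠ n in atTop, (I ^ (n + 1)).colon (I : Set A) ≤ I ^ n := by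
  obtain ⟨r, a, ha⟩ := Submodule.fg_iff_exists_fin_generating_family.mp (IsNoetherian.noetherian I)
  let φ : A →ₗ[A] (Fin r → A) := LinearMap.toSpanSingleton A _ a
  have hφ (J : Ideal A) (z : A) :
      φ z ∈ J • (⊤ : Submodule A (Fin r → A)) ↔ z ∈ J.colon (I : Set A) := by
    rw [← ha, Submodule.colon_span, mem_smul_top_pi_iff, Submodule.mem_colon, Set.forall_mem_range]
    rfl
  have hφ_inj : Function.Injective φ := by
    rw [injective_iff_map_eq_zero]
    intro z hz
    have : z ∈ (⊥ : Ideal A).colon (I : Set A) := (hφ ⊥ z).mp (by simp [hz])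
    rwa [Submodule.bot_colon, hI] at this
  obtain ⟨k, hk⟩ := I.exists_pow_inf_eq_pow_smul (LinearMap.range φ)
  filter_upwards [eventually_ge_atTop k] with n hn z hz
  have hmap : I ^ k • ⊤ ⊓ LinearMap.range φ ≤ Submodule.map φ ((I ^ k).colon (I : Set A)) := by
    rintro _ ⟨h, y, rfl⟩
    exact ⟨y, (hφ _ y).mp h, rfl⟩
  have hφz : φ z ∈ Submodule.map φ (I ^ (n + 1 - k) • (I ^ k).colon (I : Set A)) := by
    have h : φ z ∈ I ^ (n + 1) • ⊤ ⊓ LinearMap.range φ := ⟨(hφ _ z).mpr hz, z, rfl⟩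
    rw [hk (n + 1) (by omega)] at h
    rw [Submodule.map_smul'']
    exact Submodule.smul_mono le_rfl hmap h
  have hle : I * (I ^ k).colon (I : Set A) ≤ I ^ k :=
    Ideal.mul_le.mpr fun x hx y hy => by simpa [mul_comm] using Submodule.mem_colon.mp hy x hx
  rw [Submodule.mem_map] at hφz
  obtain ⟨y, hy, hyz⟩ := hφz
  obtain rfl := hφ_inj hyz
  refine (?_ : I ^ (n + 1 - k) • (I ^ k).colon (I : Set A) ≤ I ^ n) hy
  calc I ^ (n + 1 - k) * (I ^ k).colon (I : Set A)
      = I ^ (n - k) * (I * (I ^ k).colon (I : Set A)) := by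
        rw [Nat.sub_add_comm hn, pow_succ, mul_assoc]
    _ ≤ I ^ (n - k) * I ^ k := by gcongr
    _ = I ^ n := by rw [← pow_add, Nat.sub_add_cancel hn]

theorem le_pow_of_pow_mul_le {I J : Ideal A} {n₀ : ℕ}
    (hI : ∀ n ≥ n₀, (I ^ (n + 1)).colon (I : Set A) ≤ I ^ n) (k : ℕ) {n : ℕ} (hn : n₀ ≤ n)
    (hJ : I ^ k * J ≤ I ^ (n + k)) : J ≤ I ^ n := by
  induction k generalizing n with
  | zero => simpa using hJ
  | succ k ih =>
    refine ih hn (le_trans (fun z hz => ?_) (hI (n + k) (by omega)))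
    refine Submodule.mem_colon.mpr fun a ha => ?_
    rw [pow_succ', mul_assoc, ← add_assoc] at hJ
    simpa [mul_comm] using hJ (Ideal.mul_mem_mul ha hz)

theorem eventually_contentIdeal_le_pow [IsNoetherianRing A] {p : A[X]}
    (hp : p.contentIdeal.annihilator = ⊥) :
    ∀ᶠ n in atTop, ∀ z : A[X], (p * z).contentIdeal ≤ p.contentIdeal ^ (n + 1) →
      z.contentIdeal ≤ p.contentIdeal ^ n := by
  obtain ⟨n₀, h₀⟩ := eventually_atTop.mp (eventually_colon_pow_succ_le hp)
  filter_upwards [eventually_ge_atTop n₀] with n hn z hz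
  refine le_pow_of_pow_mul_le h₀ (z.natDegree + 1) hn ?_
  calc p.contentIdeal ^ (z.natDegree + 1) * z.contentIdeal
      ≤ p.contentIdeal ^ z.natDegree * (p * z).contentIdeal :=
        contentIdeal_pow_mul_contentIdeal_le p le_rfl
    _ ≤ p.contentIdeal ^ z.natDegree * p.contentIdeal ^ (n + 1) := by gcongr
    _ = p.contentIdeal ^ (n + (z.natDegree + 1)) := by rw [← pow_add]; congr 1; ring

theorem exists_contentIdeal_eq {I : Ideal A} (hI : I.FG) : ∃ p : A[X], p.contentIdeal = I := by
  classical
  obtain ⟨r, a, rfl⟩ := Submodule.fg_iff_exists_fin_generating_family.mp hI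
  refine ⟨ofFn r a, le_antisymm (contentIdeal_le_iff.mpr fun i => ?_) ?_⟩
  · rcases lt_or_ge i r with hi | hi
    · rw [ofFn_coeff_eq_val_of_lt a hi]
      exact Submodule.subset_span ⟨_, rfl⟩
    · rw [ofFn_coeff_eq_zero_of_ge a hi]
      exact zero_mem _
  · rw [Submodule.span_le, Set.range_subset_iff]
    intro i
    simpa using (ofFn r a).coeff_mem_contentIdeal i

end ContentIdeal

section Superficial

open Polynomial Filter

/-- An element `x` of the maximal ideal is superficial (of order one) if it is a non-zero-divisor
on the associated graded ring in all large degrees. -/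
structure IsSuperficial {A : Type*} [CommRing A] [IsLocalRing A] (x : A) : Prop where
  mem_maximalIdeal : x ∈ maximalIdeal A
  eventually_mem_pow : ∀ᶠ n in atTop, ∀ z, x * z ∈ maximalIdeal A ^ (n + 1) →
    z ∈ maximalIdeal A ^ n

namespace IsSuperficial

variable {A : Type*} [CommRing A] [IsLocalRing A] [IsNoetherianRing A] {x : A}

theorem mem_nonZeroDivisors (hx : IsSuperficial x) : x ∈ nonZeroDivisors A := by
  rw [mem_nonZeroDivisors_iff_right]
  intro z hz
  obtain ⟨n₀, hn₀⟩ := eventually_atTop.mp hx.eventually_mem_pow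
  rw [← Ideal.mem_bot,
    ← Ideal.iInf_pow_eq_bot_of_isLocalRing (maximalIdeal A) Ideal.IsPrime.ne_top',
    Submodule.mem_iInf]
  intro n
  refine Ideal.pow_le_pow_right (le_max_left n n₀) (hn₀ _ (le_max_right n n₀) z ?_)
  rw [mul_comm, hz]
  exact zero_mem _

theorem notMem_maximalIdeal_sq (hx : IsSuperficial x) : x ∉ maximalIdeal A ^ 2 := by
  intro hx2
  obtain ⟨n, hn⟩ := eventually_atTop.mp hx.eventually_mem_pow
  have hle : maximalIdeal A ^ n ≤ maximalIdeal A • maximalIdeal A ^ n := fun z hz => by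
    rw [smul_eq_mul, ← pow_succ']
    refine hn (n + 1) (Nat.le_succ n) z ?_
    rw [show n + 1 + 1 = 2 + n by ring, pow_add]
    exact Ideal.mul_mem_mul hx2 hz
  have hbot : maximalIdeal A ^ n = ⊥ :=
    Submodule.eq_bot_of_le_smul_of_le_jacobson_bot _ _ (IsNoetherian.noetherian _) hle
      (maximalIdeal_le_jacobson _)
  have hpow : x ^ n = 0 := by
    rw [← Ideal.mem_bot, ← hbot]
    exact Ideal.pow_mem_pow hx.mem_maximalIdeal n
  exact zero_notMem_nonZeroDivisors (hpow ▸ pow_mem hx.mem_nonZeroDivisors n)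

end IsSuperficial

theorem mem_map_of_algebraMap_mul_mem {A : Type*} [CommRing A] (S : Submonoid A) {B : Type*}
    [CommRing B] [Algebra A B] [IsLocalization S B] {J K : Ideal A} {p : A}
    (h : ∀ z, p * z ∈ J → z ∈ K) {z : B}
    (hz : algebraMap A B p * z ∈ J.map (algebraMap A B)) : z ∈ K.map (algebraMap A B) := by
  obtain ⟨q, s, rfl⟩ := IsLocalization.exists_mk'_eq S z
  rw [← IsLocalization.mk'_one (M := S) B p, ← IsLocalization.mk'_mul,
    IsLocalization.mk'_mem_map_algebraMap_iff] at hz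
  rw [IsLocalization.mk'_mem_map_algebraMap_iff]
  obtain ⟨t, ht, htJ⟩ := hz
  exact ⟨t, ht, h _ (by rwa [mul_left_comm])⟩

end Superficial

section Nagata

open Polynomial Filter

instance isPrime_map_C_maximalIdeal (A : Type*) [CommRing A] [IsLocalRing A] :
    ((maximalIdeal A).map (C : A →+* A[X])).IsPrime :=
  Ideal.isPrime_map_C_of_isPrime

/-- The Nagata ring `A(X)` of a local ring `A`, the localization of `A[X]` at `𝔪 A[X]`: a
faithfully flat extension with maximal ideal `𝔪 A(X)` in which superficial elements exist even if
the residue field of `A` is finite. -/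
abbrev NagataRing (A : Type*) [CommRing A] [IsLocalRing A] :=
  Localization.AtPrime ((maximalIdeal A).map (C : A →+* A[X]))

namespace NagataRing

variable (A : Type*) [CommRing A] [IsLocalRing A]

theorem map_algebraMap_eq (I : Ideal A) :
    I.map (algebraMap A (NagataRing A)) =
      (I.map (C : A →+* A[X])).map (algebraMap A[X] (NagataRing A)) := by
  rw [IsScalarTower.algebraMap_eq A A[X] (NagataRing A), ← Ideal.map_map]
  rfl

theorem maximalIdeal_eq_map :
    maximalIdeal (NagataRing A) = (maximalIdeal A).map (algebraMap A (NagataRing A)) := by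
  rw [map_algebraMap_eq, Localization.AtPrime.map_eq_maximalIdeal]

theorem maximalIdeal_pow_eq_map (n : ℕ) :
    maximalIdeal (NagataRing A) ^ n =
      ((maximalIdeal A ^ n).map (C : A →+* A[X])).map (algebraMap A[X] (NagataRing A)) := by
  rw [maximalIdeal_eq_map, ← Ideal.map_pow, map_algebraMap_eq]

instance : IsLocalHom (algebraMap A (NagataRing A)) :=
  ((local_hom_TFAE (algebraMap A (NagataRing A))).out 0 2).mpr (maximalIdeal_eq_map A).ge

instance : Module.FaithfullyFlat A (NagataRing A) :=
  have : Module.Flat A (NagataRing A) := Module.Flat.trans A A[X] (NagataRing A)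
  Module.FaithfullyFlat.of_flat_of_isLocalHom

theorem ringKrullDim_eq [IsNoetherianRing A] : ringKrullDim (NagataRing A) = ringKrullDim A := by
  rw [IsLocalization.AtPrime.ringKrullDim_eq_height ((maximalIdeal A).map (C : A →+* A[X])),
    Polynomial.height_map_C, maximalIdeal_height_eq_ringKrullDim]

theorem exists_isSuperficial [IsNoetherianRing A] (h : (maximalIdeal A).annihilator = ⊥) :
    ∃ x : NagataRing A, IsSuperficial x := by
  obtain ⟨p, hp⟩ := exists_contentIdeal_eq (IsNoetherian.noetherian (maximalIdeal A))
  have hmap (I : Ideal A) (z : A[X]) :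
      z ∈ I.map (C : A →+* A[X]) ↔ z.contentIdeal ≤ I := by
    rw [Ideal.mem_map_C_iff, contentIdeal_le_iff]
  refine ⟨algebraMap A[X] (NagataRing A) p, ?_, ?_⟩
  · rw [← pow_one (maximalIdeal (NagataRing A)), maximalIdeal_pow_eq_map]
    exact Ideal.mem_map_of_mem _ ((hmap _ p).mpr (by rw [hp, pow_one]))
  · filter_upwards [eventually_contentIdeal_le_pow (p := p) (by rwa [hp])] with n hn z hz
    rw [maximalIdeal_pow_eq_map] at hz ⊢
    refine mem_map_of_algebraMap_mul_mem ((maximalIdeal A).map C).primeCompl (fun q hq => ?_) hz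
    rw [hmap, ← hp] at hq ⊢
    exact hn q hq

end NagataRing

end Nagata

section ExactOn

open Matrix TensorProduct

/-- The pair of composable matrices `M`, `N` is exact on vectors with entries in `I`: each such
vector killed by `N` lies in the image of `M`. For `I = ⊤` and `N * M = 0` this is exactness of the
linear maps; for `I = 𝔪` it is the weakening that the presentation matrix of `k` satisfies together
with the zero map, and that passes to the quotient by a superficial element. -/
def ExactOn {A : Type*} [CommRing A] {l m n : Type*} [Fintype l] [Fintype m] (I : Ideal A)
    (M : Matrix m l A) (N : Matrix n m A) : Prop :=
  ∀ u : m → A, (∀ j, u j ∈ I) → N *ᵥ u = 0 → ∃ w, M *ᵥ w = u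

theorem map_mulVec_comp {A B : Type*} [CommRing A] [CommRing B] {m n : Type*} [Fintype n]
    (φ : A →+* B) (M : Matrix m n A) (w : n → A) : M.map φ *ᵥ (φ ∘ w) = φ ∘ (M *ᵥ w) :=
  (funext fun i => RingHom.map_mulVec φ M w i).symm

theorem exists_eq_add_smul_of_mk_comp_eq {A : Type*} [CommRing A] {m : Type*} {x : A}
    {u v : m → A}
    (h : Ideal.Quotient.mk (Ideal.span {x}) ∘ u = Ideal.Quotient.mk (Ideal.span {x}) ∘ v) :
    ∃ t, u = v + x • t := by
  have hdvd (j : m) : ∃ t, u j - v j = x * t :=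
    Ideal.mem_span_singleton.mp (Ideal.Quotient.eq.mp (congrFun h j))
  choose t ht using hdvd
  exact ⟨t, funext fun j => by simp [← ht j]⟩

theorem eq_zero_of_smul_eq_zero_of_mem_nonZeroDivisors {A : Type*} [CommRing A] {m : Type*}
    {x : A} (hx : x ∈ nonZeroDivisors A) {v : m → A} (h : x • v = 0) : v = 0 :=
  funext fun j => (mul_left_mem_nonZeroDivisors_eq_zero_iff hx).mp (congrFun h j)

namespace ExactOn

variable {A : Type*} [CommRing A] {k l m n : Type*} [Fintype k] [Fintype l]

section Quotient

variable {x : A} {I : Ideal A} {M : Matrix l k A} {N : Matrix m l A} {P : Matrix n m A}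

theorem of_quotient [IsLocalRing A] [IsNoetherianRing A] (hx : x ∈ nonZeroDivisors A)
    (hxm : x ∈ maximalIdeal A) (hNM : N * M = 0)
    (h : ExactOn ⊤ (M.map (Ideal.Quotient.mk (Ideal.span {x})))
      (N.map (Ideal.Quotient.mk (Ideal.span {x})))) : ExactOn ⊤ M N := by
  set π := Ideal.Quotient.mk (Ideal.span {x})
  suffices LinearMap.ker N.mulVecLin ≤ LinearMap.range M.mulVecLin from fun u _ hu => this hu
  refine Submodule.le_of_le_smul_of_le_jacobson_bot (I := maximalIdeal A)
    (IsNoetherian.noetherian _) (maximalIdeal_le_jacobson _) fun u hu => ?_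
  rw [LinearMap.mem_ker, mulVecLin_apply] at hu
  obtain ⟨w', hw'⟩ := h (π ∘ u) (fun _ => Submodule.mem_top) (by
    rw [map_mulVec_comp, hu]
    ext
    simp)
  obtain ⟨w, rfl⟩ := Ideal.Quotient.mk_surjective.comp_left w'
  obtain ⟨t, ht⟩ := exists_eq_add_smul_of_mk_comp_eq (hw'.symm.trans (map_mulVec_comp π M w))
  have hNt : N *ᵥ t = 0 := eq_zero_of_smul_eq_zero_of_mem_nonZeroDivisors hx (by
    rwa [ht, mulVec_add, mulVec_mulVec, hNM, zero_mulVec, zero_add, mulVec_smul] at hu)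
  rw [ht]
  exact Submodule.add_mem_sup ⟨w, rfl⟩ (Submodule.smul_mem_smul hxm hNt)

variable [Fintype m]

/-- The case `I = ⊤` needs exactness of the next pair only; for a proper ideal `I` one has to know
that the multiples of `x` in `N I` come from `x I`. -/
theorem quotient (hx : x ∈ nonZeroDivisors A) (hxI : x ∈ I)
    (hNI : ∀ u v, (∀ j, u j ∈ I) → N *ᵥ u = x • v → ∀ j, v j ∈ I) (hPN : P * N = 0)
    (h₁ : ExactOn I M N) (h₂ : ExactOn I N P) :
    ExactOn (I.map (Ideal.Quotient.mk (Ideal.span {x})))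
      (M.map (Ideal.Quotient.mk (Ideal.span {x})))
      (N.map (Ideal.Quotient.mk (Ideal.span {x}))) := by
  set π := Ideal.Quotient.mk (Ideal.span {x}) with hπ
  intro u hu hNu
  have hlift (j) : ∃ a ∈ I, π a = u j :=
    (Ideal.mem_map_iff_of_surjective π Ideal.Quotient.mk_surjective).mp (hu j)
  choose u' hu'I hu' using hlift
  obtain rfl : π ∘ u' = u := funext hu'
  obtain ⟨v, hv⟩ : ∃ v, N *ᵥ u' = 0 + x • v := exists_eq_add_smul_of_mk_comp_eq (by
    rw [← hπ, ← map_mulVec_comp, hNu]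
    ext
    simp)
  rw [zero_add] at hv
  have hPv : P *ᵥ v = 0 := eq_zero_of_smul_eq_zero_of_mem_nonZeroDivisors hx (by
    rw [← mulVec_smul, ← hv, mulVec_mulVec, hPN, zero_mulVec])
  obtain ⟨w, hw⟩ := h₂ v (hNI u' v hu'I hv) hPv
  obtain ⟨t, ht⟩ := h₁ (u' - x • w)
    (fun j => I.sub_mem (hu'I j) (I.mul_mem_right _ hxI))
    (by rw [mulVec_sub, mulVec_smul, hw, hv, sub_self])
  refine ⟨π ∘ t, ?_⟩
  have hx0 : π x = 0 := Ideal.Quotient.mk_singleton_self x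
  rw [map_mulVec_comp, ht]
  ext j
  simp [hx0]

theorem quotient_top (hx : x ∈ nonZeroDivisors A) (hPN : P * N = 0)
    (h₁ : ExactOn ⊤ M N) (h₂ : ExactOn ⊤ N P) :
    ExactOn ⊤ (M.map (Ideal.Quotient.mk (Ideal.span {x})))
      (N.map (Ideal.Quotient.mk (Ideal.span {x}))) := by
  simpa only [Ideal.map_top] using
    h₁.quotient hx Submodule.mem_top (fun _ _ _ _ _ => Submodule.mem_top) hPN h₂

theorem quotient_maximalIdeal [IsLocalRing A] [IsLocalRing (A ⧸ Ideal.span {x})]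
    (hx : x ∈ nonZeroDivisors A) (hxm : x ∈ maximalIdeal A) (hxm2 : x ∉ maximalIdeal A ^ 2)
    (hN : ∀ i j, N i j ∈ maximalIdeal A) (hPN : P * N = 0)
    (h₁ : ExactOn (maximalIdeal A) M N) (h₂ : ExactOn (maximalIdeal A) N P) :
    ExactOn (maximalIdeal (A ⧸ Ideal.span {x})) (M.map (Ideal.Quotient.mk (Ideal.span {x})))
      (N.map (Ideal.Quotient.mk (Ideal.span {x}))) := by
  rw [← map_maximalIdeal_of_surjective _ Ideal.Quotient.mk_surjective]
  refine h₁.quotient hx hxm (fun u v hu hv j => ?_) hPN h₂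
  by_contra hvj
  refine hxm2 ((Ideal.mul_unit_mem_iff_mem _ (notMem_maximalIdeal.mp hvj)).mp ?_)
  have hxv : (N *ᵥ u) j = x * v j := congrFun hv j
  rw [← hxv, pow_two]
  exact Ideal.sum_mem _ fun i _ => Ideal.mul_mem_mul (hN j i) (hu i)

end Quotient

section BaseChange

variable (B : Type*) [CommRing B] [Algebra A B]

theorem ker_lTensor_le_ker_lTensor [Module.Flat A B] {X Y Z : Type*} [AddCommGroup X] [Module A X]
    [AddCommGroup Y] [Module A Y] [AddCommGroup Z] [Module A Z] {g : X →ₗ[A] Y} {h : X →ₗ[A] Z}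
    (hgh : LinearMap.ker g ≤ LinearMap.ker h) :
    LinearMap.ker (g.lTensor B) ≤ LinearMap.ker (h.lTensor B) := by
  intro x hx
  obtain ⟨y, rfl⟩ := (Module.Flat.lTensor_exact B (LinearMap.exact_subtype_ker_map g) x).mp hx
  have hzero : h ∘ₗ (LinearMap.ker g).subtype = 0 := LinearMap.ext fun y => hgh y.2
  rw [LinearMap.mem_ker, ← LinearMap.comp_apply, ← LinearMap.lTensor_comp, hzero,
    LinearMap.lTensor_zero, LinearMap.zero_apply]

theorem piScalarRight_lTensor_mulVecLin [DecidableEq k] [DecidableEq l] (M : Matrix l k A)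
    (x : B ⊗[A] (k → A)) :
    piScalarRight A B B l (M.mulVecLin.lTensor B x) =
      M.map (algebraMap A B) *ᵥ piScalarRight A B B k x := by
  induction x with
  | zero => simp
  | add x y hx hy => simp only [map_add, hx, hy, mulVec_add]
  | tmul b v =>
    ext i
    simp [mulVec, dotProduct, Algebra.smul_def, Finset.sum_mul, mul_assoc]

theorem exists_mulVec_map_algebraMap_eq_iff [DecidableEq l] (M : Matrix l k A)
    (x : B ⊗[A] (l → A)) :
    (∃ w, M.map (algebraMap A B) *ᵥ w = piScalarRight A B B l x) ↔
      (LinearMap.range M.mulVecLin).mkQ.lTensor B x = 0 := by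
  classical
  rw [lTensor_exact B (LinearMap.exact_map_mkQ_range _) (Submodule.mkQ_surjective _) x,
    Set.mem_range, (piScalarRight A B B k).surjective.exists]
  simp only [← piScalarRight_lTensor_mulVecLin, EmbeddingLike.apply_eq_iff_eq]

theorem exists_piScalarRight_lTensor_subtype_eq [DecidableEq l] {I : Ideal A} {u : l → B}
    (hu : ∀ j, u j ∈ I.map (algebraMap A B)) :
    ∃ x : B ⊗[A] (I • ⊤ : Submodule A (l → A)),
      piScalarRight A B B l ((I • ⊤ : Submodule A (l → A)).subtype.lTensor B x) = u := by
  let S : Submodule B (l → B) := LinearMap.range ((piScalarRight A B B l).toLinearMap ∘ₗ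
    AlgebraTensorModule.lTensor B B (I • ⊤ : Submodule A (l → A)).subtype)
  suffices u ∈ S from this
  have hsingle (j : l) : I.map (algebraMap A B) ≤ S.comap (LinearMap.single B (fun _ => B) j) := by
    rw [Ideal.map_le_iff_le_comap]
    intro a ha
    refine ⟨1 ⊗ₜ ⟨Pi.single j a, mem_smul_top_pi_iff.mpr fun i => ?_⟩, ?_⟩
    · rcases eq_or_ne i j with rfl | hij
      · simpa using ha
      · simp [Pi.single_eq_of_ne hij]
    · ext i
      rcases eq_or_ne i j with rfl | hij
      · simp [Algebra.smul_def]
      · simp [Pi.single_eq_of_ne hij]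
  rw [← Finset.univ_sum_single u]
  exact Submodule.sum_mem _ fun j _ => hsingle j (hu j)

theorem baseChange [Finite m] [Module.Flat A B] {I : Ideal A} {M : Matrix l k A}
    {N : Matrix m l A} (h : ExactOn I M N) :
    ExactOn (I.map (algebraMap A B)) (M.map (algebraMap A B)) (N.map (algebraMap A B)) := by
  classical
  cases nonempty_fintype m
  intro u hu hNu
  obtain ⟨x, rfl⟩ := exists_piScalarRight_lTensor_subtype_eq B hu
  rw [← piScalarRight_lTensor_mulVecLin, EmbeddingLike.map_eq_zero_iff,
    ← LinearMap.comp_apply, ← LinearMap.lTensor_comp] at hNu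
  rw [exists_mulVec_map_algebraMap_eq_iff, ← LinearMap.comp_apply, ← LinearMap.lTensor_comp]
  refine ker_lTensor_le_ker_lTensor B (fun v hv => ?_) hNu
  exact (Submodule.Quotient.mk_eq_zero _).mpr (h v (mem_smul_top_pi_iff.mp v.2) hv)

theorem baseChange_top [Finite m] [Module.Flat A B] {M : Matrix l k A} {N : Matrix m l A}
    (h : ExactOn ⊤ M N) : ExactOn ⊤ (M.map (algebraMap A B)) (N.map (algebraMap A B)) := by
  simpa only [Ideal.map_top] using h.baseChange B

theorem of_baseChange [Module.FaithfullyFlat A B] {M : Matrix l k A} {N : Matrix m l A}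
    (h : ExactOn ⊤ (M.map (algebraMap A B)) (N.map (algebraMap A B))) : ExactOn ⊤ M N := by
  classical
  intro u _ hNu
  have hzero : (LinearMap.range M.mulVecLin).mkQ.lTensor B (1 ⊗ₜ u) = 0 := by
    refine (exists_mulVec_map_algebraMap_eq_iff B M _).mp (h _ (fun _ => Submodule.mem_top) ?_)
    have hpi : piScalarRight A B B l (1 ⊗ₜ u) = algebraMap A B ∘ u :=
      funext fun j => by simp [Algebra.smul_def]
    rw [hpi, map_mulVec_comp, hNu]
    ext
    simp
  exact (Submodule.Quotient.mk_eq_zero _).mp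
    (Module.FaithfullyFlat.tensorProduct_mk_injective (B := B) _
      (hzero.trans (TensorProduct.tmul_zero _ _).symm))

end BaseChange

end ExactOn

end ExactOn

section BackwardDiff

open Polynomial

/-- The backward difference `P(X) - P(X - 1)` of a polynomial. -/
noncomputable def backwardDiff {A : Type*} [CommRing A] (P : A[X]) : A[X] := P - taylor (-1) P

variable {A : Type*} [CommRing A]

theorem eval_backwardDiff (P : A[X]) (t : A) :
    (backwardDiff P).eval t = P.eval t - P.eval (t - 1) := by
  rw [backwardDiff, eval_sub, taylor_eval, sub_eq_add_neg t]

theorem eval_iterate_backwardDiff (P : A[X]) (s : ℕ) (t : A) :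
    (backwardDiff^[s] P).eval t = ((fwdDiff 1)^[s] P.eval) (t - s) := by
  induction s generalizing t with
  | zero => simp
  | succ s ih =>
    rw [Function.iterate_succ_apply', Function.iterate_succ_apply', eval_backwardDiff, ih, ih,
      fwdDiff, Nat.cast_succ, sub_add_eq_sub_sub, sub_add_cancel, sub_right_comm]

theorem factorial_mul_leadingCoeff_of_iterate_backwardDiff_eq_C [IsDomain A] [CharZero A] {s : ℕ}
    {P : A[X]} {c : A} (hc : c ≠ 0) (h : backwardDiff^[s] P = C c) :
    s.factorial * P.leadingCoeff = c := by
  have hs : (fwdDiff 1)^[s] P.eval = fun _ => c := funext fun t => by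
    simpa [h] using (eval_iterate_backwardDiff P s (t + s)).symm
  rcases lt_trichotomy P.natDegree s with hlt | rfl | hgt
  · rw [fwdDiff_iter_eq_zero_of_degree_lt hlt] at hs
    exact absurd (congrFun hs 0).symm hc
  · rw [fwdDiff_iter_degree_eq_factorial] at hs
    simpa [mul_comm] using congrFun hs 0
  · have hzero : (fwdDiff 1)^[P.natDegree] P.eval = 0 := by
      obtain ⟨k, hk⟩ := Nat.exists_eq_add_of_lt hgt
      rw [hk, show s + k + 1 = k + (s + 1) by ring, Function.iterate_add_apply,
        Function.iterate_succ_apply', hs, fwdDiff_const]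
      exact Function.iterate_fixed (fwdDiff_const 1 0) k
    rw [fwdDiff_iter_degree_eq_factorial] at hzero
    have hP : P ≠ 0 := fun hP => by simp [hP] at hgt
    simpa [hP, Nat.factorial_ne_zero] using congrFun hzero 0

end BackwardDiff

section Length

variable {A : Type*} [CommRing A] {x : A} {I J : Ideal A}

theorem exact_mapQ_mulLeft_factor (h : I ≤ Submodule.comap (LinearMap.mulLeft A x) J) :
    Function.Exact (Submodule.mapQ I J (LinearMap.mulLeft A x) h)
      (Submodule.factor (le_sup_left : J ≤ J ⊔ Ideal.span {x})) := by
  have hrange : LinearMap.range (LinearMap.mulLeft A x) = Ideal.span {x} := by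
    ext y
    simp [Ideal.mem_span_singleton', mul_comm]
  rw [LinearMap.exact_iff]
  simp [Submodule.factor, Submodule.mapQ, Submodule.ker_liftQ, Submodule.range_liftQ,
    Submodule.map_sup, LinearMap.range_comp, hrange]

theorem length_quotient_le (h : I ≤ Submodule.comap (LinearMap.mulLeft A x) J) :
    Module.length A (A ⧸ J) ≤
      Module.length A (A ⧸ I) + Module.length A (A ⧸ (J ⊔ Ideal.span {x})) := by
  rw [Module.length_eq_add_of_exact _ _ (Submodule.subtype_injective _)
    (Submodule.factor_surjective (le_sup_left : J ≤ J ⊔ Ideal.span {x}))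
    (LinearMap.exact_subtype_ker_map _), LinearMap.exact_iff.mp (exact_mapQ_mulLeft_factor h)]
  gcongr
  exact Module.length_le_of_surjective _ (LinearMap.surjective_rangeRestrict _)

theorem length_quotient_eq (h : I = Submodule.comap (LinearMap.mulLeft A x) J) :
    Module.length A (A ⧸ J) =
      Module.length A (A ⧸ I) + Module.length A (A ⧸ (J ⊔ Ideal.span {x})) := by
  refine Module.length_eq_add_of_exact _ _ ?_ (Submodule.factor_surjective _)
    (exact_mapQ_mulLeft_factor h.le)
  rw [← LinearMap.ker_eq_bot]
  simp [Submodule.mapQ, Submodule.ker_liftQ, LinearMap.ker_comp, ← h]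

variable (I J) in
theorem length_quotient_map_mk :
    Module.length (A ⧸ I) ((A ⧸ I) ⧸ J.map (Ideal.Quotient.mk I)) =
      Module.length A (A ⧸ (J ⊔ I)) := by
  rw [← Module.length_eq_of_surjective (R := A ⧸ I) (S := A) Ideal.Quotient.mk_surjective,
    sup_comm]
  exact (DoubleQuot.quotQuotEquivQuotSupₐ A I J).toLinearEquiv.length_eq

variable [IsLocalRing A]

theorem length_quotient_maximalIdeal : Module.length A (A ⧸ maximalIdeal A) = 1 :=
  Module.length_eq_one_iff.mpr (isSimpleModule_iff_isCoatom.mpr (maximalIdeal.isMaximal A).out)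

theorem length_quotient_span_singleton_quotient_maximalIdeal_pow (x : A)
    [IsLocalRing (A ⧸ Ideal.span {x})] (n : ℕ) :
    Module.length (A ⧸ Ideal.span {x})
        ((A ⧸ Ideal.span {x}) ⧸ maximalIdeal (A ⧸ Ideal.span {x}) ^ n) =
      Module.length A (A ⧸ (maximalIdeal A ^ n ⊔ Ideal.span {x})) := by
  rw [← length_quotient_map_mk, Ideal.map_pow,
    map_maximalIdeal_of_surjective _ Ideal.Quotient.mk_surjective]

theorem NagataRing.length_quotient_maximalIdeal_pow (n : ℕ) :
    Module.length (NagataRing A) (NagataRing A ⧸ maximalIdeal (NagataRing A) ^ n) =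
      Module.length A (A ⧸ maximalIdeal A ^ n) := by
  have hbaseChange := length_baseChange A (NagataRing A) (A ⧸ maximalIdeal A ^ n)
  rwa [← maximalIdeal_eq_map, length_quotient_maximalIdeal, mul_one,
    ← (Algebra.TensorProduct.quotIdealMapEquivTensorQuot (NagataRing A)
      (maximalIdeal A ^ n)).toLinearEquiv.length_eq, Ideal.map_pow, ← maximalIdeal_eq_map]
    at hbaseChange

variable [IsNoetherianRing A]

variable (A) in
theorem length_quotient_maximalIdeal_pow_ne_top (n : ℕ) :
    Module.length A (A ⧸ maximalIdeal A ^ n) ≠ ⊤ := by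
  have hdim : Ring.KrullDimLE 0 (A ⧸ maximalIdeal A ^ n) := by
    refine Ring.krullDimLE_zero_iff.mpr fun P hP => ?_
    have hle : maximalIdeal A ≤ P.comap (algebraMap A (A ⧸ maximalIdeal A ^ n)) :=
      Ideal.IsPrime.le_of_pow_le (Ideal.mk_ker.ge.trans (Ideal.ker_le_comap _))
    refine Ideal.isMaximal_of_isIntegral_of_isMaximal_comap (R := A) P ?_
    rw [← (maximalIdeal.isMaximal A).eq_of_le Ideal.IsPrime.ne_top' hle]
    exact maximalIdeal.isMaximal A
  have := isArtinianRing_iff_krullDimLE_zero.mpr hdim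
  rw [Module.length_eq_of_surjective (R := A ⧸ maximalIdeal A ^ n) (S := A)
    Ideal.Quotient.mk_surjective]
  exact Module.length_ne_top

theorem length_quotient_maximalIdeal_sq_le {x : A} (hx : x ∈ maximalIdeal A)
    [IsLocalRing (A ⧸ Ideal.span {x})] :
    (Module.length A (A ⧸ maximalIdeal A ^ 2)).toNat ≤
      (Module.length (A ⧸ Ideal.span {x}) ((A ⧸ Ideal.span {x}) ⧸
        maximalIdeal (A ⧸ Ideal.span {x}) ^ 2)).toNat + 1 := by
  have hfin := length_quotient_maximalIdeal_pow_ne_top (A ⧸ Ideal.span {x}) 2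
  have hle : maximalIdeal A ≤ Submodule.comap (LinearMap.mulLeft A x) (maximalIdeal A ^ 2) := by
    intro a ha
    simpa [pow_two] using Ideal.mul_mem_mul hx ha
  have hlength := length_quotient_le hle
  rw [← length_quotient_span_singleton_quotient_maximalIdeal_pow,
    length_quotient_maximalIdeal] at hlength
  have := ENat.toNat_le_toNat hlength (by simp [hfin])
  rw [ENat.toNat_add ENat.one_ne_top hfin] at this
  simpa [add_comm] using this

theorem length_quotient_maximalIdeal_sq :
    (Module.length A (A ⧸ maximalIdeal A ^ 2)).toNat = (maximalIdeal A).spanFinrank + 1 := by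
  have hexact : Function.Exact (maximalIdeal A).cotangentToQuotientSquare
      (Submodule.factor (Ideal.pow_le_self two_ne_zero : maximalIdeal A ^ 2 ≤ maximalIdeal A)) := by
    intro y
    obtain ⟨y, rfl⟩ := Submodule.mkQ_surjective _ y
    rw [← LinearMap.coe_range, SetLike.mem_coe, Ideal.range_cotangentToQuotientSquare]
    exact (Submodule.Quotient.mk_eq_zero _).trans Ideal.mk_mem_cotangentIdeal.symm
  have hcotangent : Module.length A (maximalIdeal A).Cotangent =
      ((maximalIdeal A).spanFinrank : ℕ∞) := by
    rw [spanFinrank_maximalIdeal_eq_finrank_cotangentSpace, ← Module.length_eq_finrank]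
    exact Module.length_eq_of_surjective (R := ResidueField A) (S := A)
      (M := (maximalIdeal A).Cotangent) Ideal.Quotient.mk_surjective
  rw [Module.length_eq_add_of_exact _ _ (Ideal.cotangentToQuotientSquare_injective _)
    (Submodule.factor_surjective _) hexact, hcotangent, length_quotient_maximalIdeal]
  exact ENat.toNat_natCast (_ + 1)

theorem maximalIdeal_sq_eq_bot_of_length_le [IsArtinianRing A]
    (h : Module.length A A ≤ Module.length A (A ⧸ maximalIdeal A ^ 2)) :
    maximalIdeal A ^ 2 = ⊥ := by
  by_contra hne
  exact (Submodule.length_quotient_lt (R := A) (M := A) _ hne).not_ge h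

end Length

section HilbertSamuel

open Polynomial

variable {A : Type u} [CommRing A] [IsLocalRing A] [IsNoetherianRing A] {P : ℚ[X]}

namespace IsHilbertSamuelPolynomial

theorem nagataRing (hP : IsHilbertSamuelPolynomial A P) :
    IsHilbertSamuelPolynomial (NagataRing A) P := by
  filter_upwards [hP] with n hn
  rw [hn, NagataRing.length_quotient_maximalIdeal_pow]

theorem quotient (hP : IsHilbertSamuelPolynomial A P) {x : A} (hx : IsSuperficial x)
    [IsLocalRing (A ⧸ Ideal.span {x})] :
    IsHilbertSamuelPolynomial (A ⧸ Ideal.span {x}) (backwardDiff P) := by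
  rw [IsHilbertSamuelPolynomial, ← Filter.map_add_atTop_eq_nat 1, Filter.eventually_map]
  filter_upwards [hP, (Filter.tendsto_add_atTop_nat 1).eventually hP,
    (Filter.tendsto_add_atTop_nat 1).eventually hx.eventually_mem_pow] with n hn hn1 hcolon
  have hlength := length_quotient_eq (x := x) (I := maximalIdeal A ^ (n + 1))
    (J := maximalIdeal A ^ (n + 1 + 1)) <| le_antisymm
      (fun a ha => by simpa [pow_succ'] using Ideal.mul_mem_mul hx.mem_maximalIdeal ha)
      hcolon
  rw [← length_quotient_span_singleton_quotient_maximalIdeal_pow] at hlength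
  rw [eval_backwardDiff, hn1, Nat.cast_succ, add_sub_cancel_right, hn, hlength, ENat.toNat_add
    (length_quotient_maximalIdeal_pow_ne_top A _) (length_quotient_maximalIdeal_pow_ne_top _ _)]
  push_cast
  ring

theorem eq_C (hP : IsHilbertSamuelPolynomial A P) [IsArtinianRing A] :
    P = C ((Module.length A A).toNat : ℚ) := by
  obtain ⟨k, hk⟩ := (isArtinianRing_iff_isNilpotent_maximalIdeal A).mp ‹_›
  have heval : ∀ᶠ n : ℕ in Filter.atTop, P.eval (n : ℚ) = (Module.length A A).toNat := by
    filter_upwards [hP, Filter.eventually_ge_atTop k] with n hn hkn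
    rw [hn, pow_eq_zero_of_le (Nat.le_succ_of_le hkn) hk]
    exact congrArg (fun l : ℕ∞ => (l.toNat : ℚ))
      (Submodule.quotEquivOfEqBot (⊥ : Submodule A A) rfl).length_eq
  refine Polynomial.eq_of_infinite_eval_eq _ _ ?_
  refine ((Nat.frequently_atTop_iff_infinite.mp heval.frequently).image
    Nat.cast_injective.injOn).mono ?_
  rintro _ ⟨n, hn, rfl⟩
  simpa using hn

end IsHilbertSamuelPolynomial

end HilbertSamuel

section Reduction

open Matrix

/-- A sequence of matrices `d 0`, `d 1`, … whose consecutive products vanish: the differentials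
`A ^ c (n + 1) → A ^ c n` of a complex of finite free modules. -/
structure MatrixComplex (A : Type*) [CommRing A] (c : ℕ → ℕ) where
  d : ∀ n, Matrix (Fin (c n)) (Fin (c (n + 1))) A
  d_mul_d : ∀ n, d n * d (n + 1) = 0

namespace MatrixComplex

variable {A : Type*} [CommRing A] {c : ℕ → ℕ}

/-- The base change of a complex of finite free modules along a ring homomorphism. -/
def map (D : MatrixComplex A c) {B : Type*} [CommRing B] (ψ : A →+* B) : MatrixComplex B c where
  d n := (D.d n).map ψ
  d_mul_d n := by rw [← Matrix.map_mul, D.d_mul_d, Matrix.map_zero _ (map_zero ψ)]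

theorem transpose_mul_transpose (D : MatrixComplex A c) (n : ℕ) :
    (D.d (n + 1))ᵀ * (D.d n)ᵀ = 0 := by
  rw [← Matrix.transpose_mul, D.d_mul_d, Matrix.transpose_zero]

theorem annihilator_maximalIdeal_eq_bot [IsLocalRing A] (D : MatrixComplex A c)
    (hc₀ : c 0 = 0) (hc₁ : 0 < c 1) (hmem : ∀ i j, D.d 1 i j ∈ maximalIdeal A)
    (hexact : ExactOn ⊤ (D.d 0)ᵀ (D.d 1)ᵀ) :
    (maximalIdeal A).annihilator = ⊥ := by
  refine eq_bot_iff.mpr fun b hb => ?_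
  have hcycle : (D.d 1)ᵀ *ᵥ (fun _ => b) = 0 := by
    ext i
    change ∑ k, D.d 1 k i * b = 0
    refine Finset.sum_eq_zero fun k _ => ?_
    rw [mul_comm]
    exact Submodule.mem_annihilator.mp hb _ (hmem k i)
  obtain ⟨w, hw⟩ := hexact _ (fun _ => trivial) hcycle
  have : IsEmpty (Fin (c 0)) := by rw [hc₀]; infer_instance
  simpa [Matrix.mulVec, dotProduct] using (congrFun hw ⟨0, hc₁⟩).symm

end MatrixComplex

/-- The properties of the passage from a local ring to its quotient by a superficial sequence of
length `s`, possibly after extending the residue field, that are used to pass to dimension zero. -/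
structure IsReduction {A B : Type u} [CommRing A] [IsLocalRing A] [IsNoetherianRing A]
    [CommRing B] [IsLocalRing B] [IsNoetherianRing B] (ψ : A →+* B) (s : ℕ) : Prop where
  isLocalHom : IsLocalHom ψ
  isHilbertSamuelPolynomial : ∀ P, IsHilbertSamuelPolynomial A P →
    IsHilbertSamuelPolynomial B (backwardDiff^[s] P)
  length_le : (Module.length A (A ⧸ maximalIdeal A ^ 2)).toNat ≤
    (Module.length B (B ⧸ maximalIdeal B ^ 2)).toNat + s
  exactOn_of_map : ∀ {k l m : ℕ} {M : Matrix (Fin l) (Fin k) A} {N : Matrix (Fin m) (Fin l) A},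
    N * M = 0 → ExactOn ⊤ (M.map ψ) (N.map ψ) → ExactOn ⊤ M N

namespace IsReduction

variable {A B B' : Type u} [CommRing A] [IsLocalRing A] [IsNoetherianRing A]
  [CommRing B] [IsLocalRing B] [IsNoetherianRing B]
  [CommRing B'] [IsLocalRing B'] [IsNoetherianRing B']

theorem id : IsReduction (RingHom.id A) 0 where
  isLocalHom := inferInstance
  isHilbertSamuelPolynomial _ hP := hP
  length_le := le_rfl
  exactOn_of_map _ h := by simpa using h

theorem comp {ψ : A →+* B} {ψ' : B →+* B'} {s s' : ℕ} (h' : IsReduction ψ' s')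
    (h : IsReduction ψ s) : IsReduction (ψ'.comp ψ) (s' + s) where
  isLocalHom :=
    have := h.isLocalHom
    have := h'.isLocalHom
    RingHom.isLocalHom_comp ψ' ψ
  isHilbertSamuelPolynomial P hP := by
    rw [Function.iterate_add_apply]
    exact h'.isHilbertSamuelPolynomial _ (h.isHilbertSamuelPolynomial P hP)
  length_le := by
    have := h.length_le
    have := h'.length_le
    omega
  exactOn_of_map {_ _ _ M N} hNM hexact := by
    refine h.exactOn_of_map hNM (h'.exactOn_of_map ?_ ?_)
    · rw [← Matrix.map_mul, hNM, Matrix.map_zero _ (map_zero ψ)]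
    · rwa [Matrix.map_map, Matrix.map_map]

theorem nagataRing : IsReduction (algebraMap A (NagataRing A)) 0 where
  isLocalHom := inferInstance
  isHilbertSamuelPolynomial _ hP := hP.nagataRing
  length_le := by rw [NagataRing.length_quotient_maximalIdeal_pow, add_zero]
  exactOn_of_map _ h := h.of_baseChange

theorem quotient {x : A} (hx : IsSuperficial x) [IsLocalRing (A ⧸ Ideal.span {x})] :
    IsReduction (Ideal.Quotient.mk (Ideal.span {x})) 1 where
  isLocalHom := IsLocalHom.of_surjective _ Ideal.Quotient.mk_surjective
  isHilbertSamuelPolynomial _ hP := hP.quotient hx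
  length_le := length_quotient_maximalIdeal_sq_le hx.mem_maximalIdeal
  exactOn_of_map hNM h :=
    ExactOn.of_quotient hx.mem_nonZeroDivisors hx.mem_maximalIdeal hNM h

end IsReduction

/-- The exactness properties that descend from a Cohen-Macaulay local ring of dimension `d` to its
quotient by a superficial sequence, where `s` is the dimension of the quotient: `D` is the base
change of a minimal resolution of the residue field, augmented by zero, and `T` is the base change
of a free resolution of a module `L` with `Extⁱ(L, A) = 0` for `1 ≤ i ≤ d + 1`. -/
structure IsAdapted {A : Type*} [CommRing A] [IsLocalRing A] {c t : ℕ → ℕ}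
    (D : MatrixComplex A c) (T : MatrixComplex A t) (d s : ℕ) : Prop where
  mem_maximalIdeal : ∀ n i j, D.d n i j ∈ maximalIdeal A
  exactOn_maximalIdeal : ∀ n, ExactOn (maximalIdeal A) (D.d (n + 1)) (D.d n)
  exactOn_top : ∀ n, d < n + s → ExactOn ⊤ (D.d (n + 1)) (D.d n)
  exactOn_transpose : ∀ n < s, ExactOn ⊤ (D.d n)ᵀ (D.d (n + 1))ᵀ
  exactOn_transpose_cover : ∀ n ≤ s, ExactOn ⊤ (T.d n)ᵀ (T.d (n + 1))ᵀ

namespace IsAdapted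

variable {A : Type*} [CommRing A] [IsLocalRing A] {c t : ℕ → ℕ} {D : MatrixComplex A c}
  {T : MatrixComplex A t} {d s : ℕ}

theorem nagataRing [IsNoetherianRing A] (h : IsAdapted D T d s) :
    IsAdapted (D.map (algebraMap A (NagataRing A))) (T.map (algebraMap A (NagataRing A))) d s where
  mem_maximalIdeal n i j :=
    map_nonunit (algebraMap A (NagataRing A)) _ (h.mem_maximalIdeal n i j)
  exactOn_maximalIdeal n := by
    rw [NagataRing.maximalIdeal_eq_map]
    exact (h.exactOn_maximalIdeal n).baseChange _
  exactOn_top n hn :=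
    (h.exactOn_top n hn).baseChange_top (NagataRing A)
  exactOn_transpose n hn :=
    (h.exactOn_transpose n hn).baseChange_top (NagataRing A)
  exactOn_transpose_cover n hn :=
    (h.exactOn_transpose_cover n hn).baseChange_top (NagataRing A)

theorem quotient [IsNoetherianRing A] (h : IsAdapted D T d (s + 1)) (hs : s ≤ d) (hc₀ : c 0 = 0)
    {x : A} (hx : IsSuperficial x) [IsLocalRing (A ⧸ Ideal.span {x})] :
    IsAdapted (D.map (Ideal.Quotient.mk (Ideal.span {x})))
      (T.map (Ideal.Quotient.mk (Ideal.span {x}))) d s where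
  mem_maximalIdeal n i j :=
    have := IsLocalHom.of_surjective (Ideal.Quotient.mk (Ideal.span {x}))
      Ideal.Quotient.mk_surjective
    map_nonunit (Ideal.Quotient.mk (Ideal.span {x})) _ (h.mem_maximalIdeal n i j)
  exactOn_maximalIdeal n := by
    rcases n with _ | n
    · have : IsEmpty (Fin (c 0)) := by rw [hc₀]; infer_instance
      exact ExactOn.quotient_maximalIdeal (P := (0 : Matrix (Fin 0) (Fin (c 0)) A))
        hx.mem_nonZeroDivisors hx.mem_maximalIdeal hx.notMem_maximalIdeal_sq
        (h.mem_maximalIdeal 0) (Matrix.zero_mul _) (h.exactOn_maximalIdeal 0)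
        fun _ _ _ => ⟨0, Subsingleton.elim _ _⟩
    · exact ExactOn.quotient_maximalIdeal hx.mem_nonZeroDivisors hx.mem_maximalIdeal
        hx.notMem_maximalIdeal_sq (h.mem_maximalIdeal (n + 1)) (D.d_mul_d n)
        (h.exactOn_maximalIdeal (n + 1)) (h.exactOn_maximalIdeal n)
  exactOn_top n hn := by
    obtain ⟨n, rfl⟩ : ∃ k, n = k + 1 := ⟨n - 1, by omega⟩
    exact (h.exactOn_top (n + 1) (by omega)).quotient_top hx.mem_nonZeroDivisors
      (D.d_mul_d n) (h.exactOn_top n (by omega))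
  exactOn_transpose n hn :=
    (h.exactOn_transpose n (by omega)).quotient_top hx.mem_nonZeroDivisors
      (D.transpose_mul_transpose (n + 1)) (h.exactOn_transpose (n + 1) (by omega))
  exactOn_transpose_cover n hn :=
    (h.exactOn_transpose_cover n (by omega)).quotient_top hx.mem_nonZeroDivisors
      (T.transpose_mul_transpose (n + 1)) (h.exactOn_transpose_cover (n + 1) (by omega))

theorem exists_artinian_reduction {c t : ℕ → ℕ} (hc₀ : c 0 = 0) (hc₁ : 0 < c 1) {d s : ℕ}
    (hs : s ≤ d) {A : Type u} [CommRing A] [IsLocalRing A] [IsNoetherianRing A]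
    {D : MatrixComplex A c} {T : MatrixComplex A t} (h : IsAdapted D T d s)
    (hdim : ringKrullDim A ≤ s) :
    ∃ (B : Type u) (_ : CommRing B) (_ : IsLocalRing B) (_ : IsArtinianRing B) (ψ : A →+* B),
      IsReduction ψ s ∧ IsAdapted (D.map ψ) (T.map ψ) d 0 := by
  induction s generalizing A with
  | zero =>
    have : IsArtinianRing A :=
      isArtinianRing_iff_krullDimLE_zero.mpr (Ring.krullDimLE_iff.mpr (by simpa using hdim))
    exact ⟨A, _, _, this, RingHom.id A, IsReduction.id, h⟩
  | succ s ih =>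
    obtain ⟨x, hx⟩ := NagataRing.exists_isSuperficial A
      (D.annihilator_maximalIdeal_eq_bot hc₀ hc₁ (h.mem_maximalIdeal 1)
        (h.exactOn_transpose 0 s.succ_pos))
    have : Nontrivial (NagataRing A ⧸ Ideal.span {x}) := by
      rw [Ideal.Quotient.nontrivial_iff, Ne, Ideal.span_singleton_eq_top]
      exact hx.mem_maximalIdeal
    have : IsLocalRing (NagataRing A ⧸ Ideal.span {x}) :=
      IsLocalRing.of_surjective' _ Ideal.Quotient.mk_surjective
    have hdim' : ringKrullDim (NagataRing A ⧸ Ideal.span {x}) ≤ s := by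
      rw [← NagataRing.ringKrullDim_eq A,
        ← ringKrullDim_quotient_span_singleton_succ_eq_ringKrullDim_of_mem_nonZeroDivisors
          hx.mem_nonZeroDivisors hx.mem_maximalIdeal, Nat.cast_succ] at hdim
      exact ENat.WithBot.add_le_add_one_right_iff.mp hdim
    obtain ⟨B, _, _, _, ψ, hψ, hB⟩ :=
      ih (Nat.le_of_succ_le hs) (h.nagataRing.quotient (Nat.le_of_succ_le hs) hc₀ hx) hdim'
    exact ⟨B, _, _, ‹_›, _, hψ.comp ((IsReduction.quotient hx).comp IsReduction.nagataRing), hB⟩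

end IsAdapted

theorem IsReduction.maximalIdeal_sq_eq_bot {A B : Type u} [CommRing A] [IsLocalRing A]
    [IsNoetherianRing A] [CommRing B] [IsLocalRing B] [IsArtinianRing B] {ψ : A →+* B} {d : ℕ}
    (hψ : IsReduction ψ d) (hmult : HasMinimalMultiplicity A) (hd : ringKrullDim A = d) :
    maximalIdeal B ^ 2 = ⊥ := by
  obtain ⟨d', hd', d'', P, hd'', hP, he⟩ := hmult
  obtain rfl : d = d' := by exact_mod_cast hd.symm.trans hd'
  obtain rfl : d = d'' := by exact_mod_cast hd.symm.trans hd''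
  have hlength : (Module.length B B).toNat ≠ 0 := by
    rw [Ne, ENat.toNat_eq_zero, not_or]
    exact ⟨Module.length_pos.ne', Module.length_ne_top⟩
  rw [factorial_mul_leadingCoeff_of_iterate_backwardDiff_eq_C (Nat.cast_ne_zero.mpr hlength)
    (hψ.isHilbertSamuelPolynomial P hP).eq_C, sub_add_eq_add_sub, eq_comm, eq_sub_iff_add_eq] at he
  have hsq := hψ.length_le
  rw [length_quotient_maximalIdeal_sq] at hsq
  norm_cast at he
  refine maximalIdeal_sq_eq_bot_of_length_le ?_
  rw [← ENat.natCast_toNat (Module.length_ne_top (M := B)),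
    ← ENat.natCast_toNat (length_quotient_maximalIdeal_pow_ne_top B 2), Nat.cast_le]
  omega

end Reduction

section SquareZero

open Matrix

theorem exists_comp_eq_of_ker_le_ker {R X Y Z : Type*} [Ring R] [AddCommGroup X] [Module R X]
    [AddCommGroup Y] [Module R Y] [AddCommGroup Z] [Module R Z] [IsSemisimpleModule R Y]
    {δ : X →ₗ[R] Y} {φ : X →ₗ[R] Z} (h : LinearMap.ker δ ≤ LinearMap.ker φ) :
    ∃ ψ : Y →ₗ[R] Z, ψ ∘ₗ δ = φ := by
  obtain ⟨ψ, hψ⟩ := IsSemisimpleModule.extension_property ((LinearMap.ker δ).liftQ δ le_rfl)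
    (LinearMap.ker_eq_bot.mp (Submodule.ker_liftQ_eq_bot _ _ _ le_rfl))
    ((LinearMap.ker δ).liftQ φ h)
  exact ⟨ψ, LinearMap.ext fun x => LinearMap.congr_fun hψ ((LinearMap.ker δ).mkQ x)⟩

variable {A : Type*} [CommRing A] [IsLocalRing A] {k l m p q : Type*}

/-- There is a linear map from the cokernel of `N` to the cokernel of `T` whose image is not
contained in `𝔪` times its target. The matrices `F` and `E` lift the map to the presentations `N`
and `T`, the vector `v` represents an element whose image lies outside `𝔪 • coker T`, and the
functional `g` detects this. -/
def HasNonminimalMap [Fintype k] [Fintype l] [Fintype q] (N : Matrix q p A) (T : Matrix l k A) :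
    Prop :=
  ∃ (F : Matrix l q A) (E : Matrix k p A) (v : q → A) (g : l → A),
    F * N = T * E ∧ g ⬝ᵥ F *ᵥ v = 1 ∧ ∀ i, (g ᵥ* T) i ∈ maximalIdeal A

theorem HasNonminimalMap.map [Fintype k] [Fintype l] [Fintype q] {N : Matrix q p A}
    {T : Matrix l k A} (h : HasNonminimalMap N T) {B : Type*} [CommRing B] [IsLocalRing B]
    (ψ : A →+* B) [IsLocalHom ψ] : HasNonminimalMap (N.map ψ) (T.map ψ) := by
  obtain ⟨F, E, v, g, hFN, hgv, hg⟩ := h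
  refine ⟨F.map ψ, E.map ψ, ψ ∘ v, ψ ∘ g, ?_, ?_, fun i => ?_⟩
  · rw [← Matrix.map_mul, hFN, Matrix.map_mul]
  · rw [map_mulVec_comp, ← RingHom.map_dotProduct, hgv, map_one]
  · rw [← RingHom.map_vecMul]
    exact map_nonunit ψ _ (hg i)

variable [Fintype k] [Fintype l]

theorem exists_eq_mul_of_exactOn_transpose {T₀ : Matrix l k A} {T₁ : Matrix k p A}
    (hT : T₀ * T₁ = 0) (hexact : ExactOn ⊤ T₀ᵀ T₁ᵀ) {g e : l → A} (hge : g ⬝ᵥ e = 1)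
    (hg : ∀ i, (g ᵥ* T₀) i ∈ maximalIdeal A) (he : ∀ a ∈ maximalIdeal A, ∃ w, T₀ *ᵥ w = a • e)
    (φ : maximalIdeal A →ₗ[A] A) : ∃ c, ∀ a, φ a = c * a := by
  let ξ : k → maximalIdeal A := fun i => ⟨(g ᵥ* T₀) i, hg i⟩
  have hξ (w : k → A) : ((∑ i, w i • ξ i : maximalIdeal A) : A) = g ⬝ᵥ T₀ *ᵥ w := by
    rw [dotProduct_mulVec]
    simp [ξ, dotProduct, mul_comm]
  have hcocycle : T₁ᵀ *ᵥ (φ ∘ ξ) = 0 := by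
    ext j
    have hzero : ∑ i, T₁ i j • ξ i = 0 := by
      have hcol : T₀ *ᵥ T₁.col j = 0 := congrArg (fun M : Matrix l p A => M.col j) hT
      refine Subtype.ext ((hξ (T₁.col j)).trans ?_)
      rw [hcol, dotProduct_zero, ZeroMemClass.coe_zero]
    simpa [mulVec, dotProduct] using congrArg φ hzero
  obtain ⟨u, hu⟩ := hexact _ (fun _ => trivial) hcocycle
  refine ⟨u ⬝ᵥ e, fun a => ?_⟩
  obtain ⟨w, hw⟩ := he a a.2
  have ha : ∑ i, w i • ξ i = a := Subtype.ext <| by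
    rw [hξ, hw, dotProduct_smul, hge, smul_eq_mul, mul_one]
  calc φ a = (φ ∘ ξ) ⬝ᵥ w := by
        rw [← ha, map_sum]
        simp [dotProduct, mul_comm]
    _ = u ⬝ᵥ e * a := by
        rw [← hu, mulVec_transpose, ← dotProduct_mulVec, hw, dotProduct_smul, smul_eq_mul,
          mul_comm]

theorem isSemisimpleModule_pi_maximalIdeal (hm : maximalIdeal A ^ 2 = ⊥) (ι : Type*) [Finite ι] :
    IsSemisimpleModule A (ι → maximalIdeal A) := by
  have htorsion : Module.IsTorsionBySet A (ι → maximalIdeal A) (maximalIdeal A) := by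
    intro x a
    ext i
    have hmem : (a : A) * x i ∈ maximalIdeal A ^ 2 :=
      pow_two (maximalIdeal A) ▸ Ideal.mul_mem_mul a.2 (x i).2
    simpa [hm] using hmem
  let := htorsion.module
  let := Ideal.Quotient.field (maximalIdeal A)
  exact htorsion.isSemisimpleModule_iff.mp inferInstance

theorem exactOn_transpose_of_maximalIdeal_sq_eq_bot [Fintype m] (hm : maximalIdeal A ^ 2 = ⊥)
    (hmul : ∀ φ : maximalIdeal A →ₗ[A] A, ∃ c, ∀ a, φ a = c * a)
    {M : Matrix l k A} {N : Matrix m l A} (hN : ∀ i j, N i j ∈ maximalIdeal A)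
    (h : ExactOn ⊤ M N) : ExactOn ⊤ Nᵀ Mᵀ := by
  classical
  intro u _ hMu
  have := isSemisimpleModule_pi_maximalIdeal hm m
  let δ : (l → A) →ₗ[A] (m → maximalIdeal A) :=
    LinearMap.pi fun i => ((LinearMap.proj i).comp N.mulVecLin).codRestrict (maximalIdeal A)
      fun w => Ideal.sum_mem _ fun j _ => Ideal.mul_mem_right _ _ (hN i j)
  have hδ (w : l → A) (i : m) : (δ w i : A) = (N *ᵥ w) i := rfl
  have hker : LinearMap.ker δ ≤ LinearMap.ker (dotProductBilin A A u) := by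
    intro w hw
    obtain ⟨v, rfl⟩ := h w (fun _ => trivial) <| _root_.funext fun i =>
      congrArg Subtype.val (congrFun (LinearMap.mem_ker.mp hw) i)
    rw [LinearMap.mem_ker, dotProductBilin_apply_apply, dotProduct_mulVec, ← mulVec_transpose,
      hMu, zero_dotProduct]
  obtain ⟨ψ, hψ⟩ := exists_comp_eq_of_ker_le_ker hker
  choose c hc using fun i => hmul (ψ ∘ₗ LinearMap.single A (fun _ : m => maximalIdeal A) i)
  have hψc (x : m → maximalIdeal A) : ψ x = ∑ i, c i * x i := by
    conv_lhs => rw [← Finset.univ_sum_single x]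
    rw [map_sum]
    exact Finset.sum_congr rfl fun i _ => hc i (x i)
  refine ⟨c, ?_⟩
  ext j
  calc (Nᵀ *ᵥ c) j = ψ (δ (Pi.single j 1)) := by
        simp only [hψc, hδ, mulVec_single_one]
        simp [mulVec, dotProduct, mul_comm]
    _ = u j := by
        rw [← LinearMap.comp_apply, hψ]
        simp

theorem exists_mulVec_eq_smul (hm : maximalIdeal A ^ 2 = ⊥) {M : Matrix l k A} {N : Matrix m l A}
    (hN : ∀ i j, N i j ∈ maximalIdeal A) (h : ExactOn (maximalIdeal A) M N) {a : A}
    (ha : a ∈ maximalIdeal A) (v : l → A) : ∃ w, M *ᵥ w = a • v := by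
  refine h (a • v) (fun j => Ideal.mul_mem_right _ _ ha) ?_
  ext i
  have hmem : a * (N *ᵥ v) i ∈ maximalIdeal A ^ 2 := pow_two (maximalIdeal A) ▸
    Ideal.mul_mem_mul ha (Ideal.sum_mem _ fun j _ => Ideal.mul_mem_right _ _ (hN i j))
  rw [mulVec_smul, Pi.smul_apply, smul_eq_mul]
  simpa [hm] using hmem

theorem IsAdapted.exactOn_transpose_of_lt {c t : ℕ → ℕ} {D : MatrixComplex A c}
    {T : MatrixComplex A t} {d : ℕ} (h : IsAdapted D T d 0) (hm : maximalIdeal A ^ 2 = ⊥) {n : ℕ}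
    (hmap : HasNonminimalMap (D.d (n + 1)) (T.d 0)) {i : ℕ} (hi : d < i) :
    ExactOn ⊤ (D.d i)ᵀ (D.d (i + 1))ᵀ := by
  obtain ⟨F, E, v, g, hFN, hgv, hg⟩ := hmap
  refine exactOn_transpose_of_maximalIdeal_sq_eq_bot hm ?_ (h.mem_maximalIdeal i)
    (h.exactOn_top i hi)
  refine exists_eq_mul_of_exactOn_transpose (T.d_mul_d 0) (h.exactOn_transpose_cover 0 le_rfl)
    hgv hg fun a ha => ?_
  obtain ⟨w, hw⟩ := exists_mulVec_eq_smul hm (h.mem_maximalIdeal n) (h.exactOn_maximalIdeal n) ha v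
  refine ⟨E *ᵥ w, ?_⟩
  rw [mulVec_mulVec, ← hFN, ← mulVec_mulVec, hw, mulVec_smul]

theorem IsAdapted.exactOn_transpose_of_hasMinimalMultiplicity {A : Type u} [CommRing A]
    [IsLocalRing A] [IsNoetherianRing A] (hmult : HasMinimalMultiplicity A) {d : ℕ}
    (hd : ringKrullDim A = d) {c t : ℕ → ℕ} (hc₀ : c 0 = 0) (hc₁ : 0 < c 1)
    {D : MatrixComplex A c} {T : MatrixComplex A t} (h : IsAdapted D T d d) {n : ℕ}
    (hmap : HasNonminimalMap (D.d (n + 1)) (T.d 0)) {i : ℕ} (hi : d < i) :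
    ExactOn ⊤ (D.d i)ᵀ (D.d (i + 1))ᵀ := by
  obtain ⟨B, _, _, _, ψ, hψ, hB⟩ := exists_artinian_reduction hc₀ hc₁ le_rfl h hd.le
  have := hψ.isLocalHom
  exact hψ.exactOn_of_map (D.transpose_mul_transpose i)
    (hB.exactOn_transpose_of_lt (hψ.maximalIdeal_sq_eq_bot hmult hd) (hmap.map ψ) hi)

end SquareZero

section Ext

section DimensionShift

universe v w

variable {C : Type u} [Category.{v} C] [Abelian C] [HasExt.{w} C]

theorem subsingleton_ext_of_iso {X Y : C} (e : X ≅ Y) {N : C} {i : ℕ}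
    (h : Subsingleton (Ext Y N i)) : Subsingleton (Ext X N i) := by
  refine subsingleton_of_forall_eq 0 fun x => ?_
  calc x = (Ext.mk₀ e.hom).comp ((Ext.mk₀ e.inv).comp x (zero_add i)) (zero_add i) := by simp
    _ = 0 := by rw [h.elim (Ext.comp _ x _) 0, Ext.comp_zero]

variable {S : ShortComplex C} (hS : S.ShortExact)
include hS

theorem subsingleton_ext_X₂ {N : C} {i : ℕ} (h₁ : Subsingleton (Ext S.X₁ N i))
    (h₃ : Subsingleton (Ext S.X₃ N i)) : Subsingleton (Ext S.X₂ N i) := by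
  refine subsingleton_of_forall_eq 0 fun x => ?_
  obtain ⟨y, rfl⟩ := Ext.contravariant_sequence_exact₂ hS N x (h₁.elim _ _)
  rw [h₃.elim y 0, Ext.comp_zero]

theorem subsingleton_ext_X₃_iff [Projective S.X₂] (N : C) (i : ℕ) :
    Subsingleton (Ext S.X₃ N (i + 1 + 1)) ↔ Subsingleton (Ext S.X₁ N (i + 1)) := by
  refine ⟨fun h => subsingleton_of_forall_eq 0 fun x => ?_,
    fun h => subsingleton_of_forall_eq 0 fun x => ?_⟩
  · obtain ⟨y, rfl⟩ := Ext.contravariant_sequence_exact₁ hS N x (add_comm 1 (i + 1)) (h.elim _ _)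
    rw [Ext.eq_zero_of_projective y, Ext.comp_zero]
  · obtain ⟨y, rfl⟩ := Ext.contravariant_sequence_exact₃ hS N x (Ext.eq_zero_of_projective _)
      (add_comm 1 (i + 1))
    rw [h.elim y 0, Ext.comp_zero]

theorem subsingleton_ext_one_iff [Projective S.X₂] (N : C) :
    Subsingleton (Ext S.X₃ N 1) ↔ ∀ φ : S.X₁ ⟶ N, ∃ ψ : S.X₂ ⟶ N, S.f ≫ ψ = φ := by
  refine ⟨fun h φ => ?_, fun h => subsingleton_of_forall_eq 0 fun x => ?_⟩
  · obtain ⟨y, hy⟩ := Ext.contravariant_sequence_exact₁ hS N (Ext.mk₀ φ) (add_zero 1)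
      (h.elim _ _)
    obtain ⟨ψ, rfl⟩ := (Ext.mk₀_bijective _ _).surjective y
    exact ⟨ψ, (Ext.mk₀_bijective _ _).injective ((Ext.mk₀_comp_mk₀ _ _).symm.trans hy)⟩
  · obtain ⟨y, rfl⟩ := Ext.contravariant_sequence_exact₃ hS N x (Ext.eq_zero_of_projective _)
      (add_zero 1)
    obtain ⟨φ, rfl⟩ := (Ext.mk₀_bijective _ _).surjective y
    obtain ⟨ψ, rfl⟩ := h φ
    rw [← Ext.mk₀_comp_mk₀]
    exact hS.extClass_comp_assoc _

end DimensionShift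

section InjectiveDimension

open ModuleCat (of)

variable {R : Type u} [CommRing R]

theorem hasInjectiveDimensionLE_of_subsingleton_ext (n : ℕ) (M : ModuleCat.{u} R)
    (h : ∀ I : Ideal R, Subsingleton (Ext (of R (R ⧸ I)) M (n + 1))) :
    HasInjectiveDimensionLE M n := by
  induction n generalizing M with
  | zero =>
    have hbaer : Module.Baer R M := by
      intro I φ
      have hexact := LinearMap.exact_subtype_mkQ I
      let S := ShortComplex.moduleCatMk I.subtype I.mkQ hexact.linearMap_comp_eq_zero
      have hS : S.ShortExact :=
        ModuleCat.shortComplex_shortExact S hexact I.injective_subtype I.mkQ_surjective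
      have : Projective S.X₂ := (IsProjective.iff_projective R).mp inferInstance
      obtain ⟨ψ, hψ⟩ := (subsingleton_ext_one_iff hS M).mp (h I) (ModuleCat.ofHom φ)
      exact ⟨ψ.hom, fun x hx => LinearMap.congr_fun (congrArg ModuleCat.Hom.hom hψ) ⟨x, hx⟩⟩
    have := Module.injective_object_of_injective_module R M (inj := hbaer.injective)
    exact injective_iff_hasInjectiveDimensionLT_one.mp this
  | succ n ih =>
    obtain ⟨E, _, f, _⟩ := EnoughInjectives.presentation M
    have hS : (ShortComplex.mk f (Limits.cokernel.π f) (Limits.cokernel.condition f)).ShortExact :=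
      { exact := ShortComplex.exact_cokernel f }
    refine (hS.hasInjectiveDimensionLT_X₃_iff n ‹_›).mp (ih _ fun I => ?_)
    refine subsingleton_of_forall_eq 0 fun x => ?_
    obtain ⟨y, rfl⟩ := Ext.covariant_sequence_exact₃ _ hS x rfl ((h I).elim _ _)
    rw [Ext.eq_zero_of_injective y, Ext.zero_comp]

variable [IsNoetherianRing R]

theorem subsingleton_ext_of_quotient_prime {N : ModuleCat.{u} R} {i : ℕ} {I : Ideal R}
    (h : ∀ p : Ideal R, p.IsPrime → I ≤ p → Subsingleton (Ext (of R (R ⧸ p)) N (i + 1)))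
    (M : Type u) [AddCommGroup M] [Module R M] [hM : Module.Finite R M]
    (hI : I ≤ Module.annihilator R M) : Subsingleton (Ext (of R M) N (i + 1)) := by
  induction hM using IsNoetherianRing.induction_on_isQuotientEquivQuotientPrime R with
  | subsingleton M =>
    have : Projective (of R M) := (IsProjective.iff_projective M).mp inferInstance
    exact Ext.subsingleton_of_projective (of R M) N i
  | quotient M p e =>
    refine subsingleton_ext_of_iso e.toModuleIso (h p.1 p.2 ?_)
    rwa [e.annihilator_eq, Ideal.annihilator_quotient] at hI
  | exact M₁ M₂ M₃ f g hf hg hfg h₁ h₃ =>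
    exact subsingleton_ext_X₂ (ModuleCat.shortComplex_shortExact
      (ShortComplex.moduleCatMk f g hfg.linearMap_comp_eq_zero) hfg hf hg)
      (h₁ (hI.trans (f.annihilator_le_of_injective hf)))
      (h₃ (hI.trans (g.annihilator_le_of_surjective hg)))

variable [IsLocalRing R]

theorem subsingleton_ext_of_quotSMulTop {M N : ModuleCat.{u} R} [Module.Finite R M]
    [Module.Finite R N] {x : R} (hx : x ∈ maximalIdeal R) (hreg : IsSMulRegular M x) {i : ℕ}
    (h : Subsingleton (Ext (of R (QuotSMulTop x M)) N (i + 1))) : Subsingleton (Ext M N i) := by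
  have htop : (⊤ : Submodule R (Ext M N i)) ≤ maximalIdeal R • ⊤ := by
    intro y _
    obtain ⟨z, rfl⟩ : ∃ z : Ext M N i, (Ext.mk₀ (x • 𝟙 M)).comp z (zero_add i) = y :=
      Ext.contravariant_sequence_exact₁ hreg.smulShortComplex_shortExact N y (add_comm 1 i)
        (h.elim _ _)
    rw [Ext.mk₀_smul, Ext.smul_comp, Ext.mk₀_id_comp]
    exact Submodule.smul_mem_smul hx trivial
  refine (Submodule.subsingleton_iff R).mp (subsingleton_of_bot_eq_top ?_)
  exact (Submodule.eq_bot_of_le_smul_of_le_jacobson_bot (maximalIdeal R) _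
    (Module.finite_def.mp inferInstance) htop (maximalIdeal_le_jacobson _)).symm

theorem subsingleton_ext_quotient_prime {N : ModuleCat.{u} R} [Module.Finite R N] {d : ℕ}
    (h : ∀ i > d, Subsingleton (Ext (of R (ResidueField R)) N i)) (p : Ideal R)
    (hp : p.IsPrime) : ∀ i > d, Subsingleton (Ext (of R (R ⧸ p)) N i) := by
  induction p using IsNoetherian.induction with
  | _ p ih =>
    rcases (le_maximalIdeal hp.ne_top).eq_or_lt with rfl | hlt
    · exact h
    intro i hi
    obtain ⟨x, hxm, hxp⟩ := SetLike.exists_of_lt hlt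
    have hreg : IsSMulRegular (R ⧸ p) x :=
      (isSMulRegular_quotient_iff_mem_of_smul_mem p x).mpr fun y hy =>
        (hp.mem_or_mem hy).resolve_left hxp
    have hp_ann : p ≤ Module.annihilator R (QuotSMulTop x (R ⧸ p)) :=
      Ideal.annihilator_quotient.ge.trans
        ((Submodule.mkQ _).annihilator_le_of_surjective (Submodule.mkQ_surjective _))
    have hx_ann : Ideal.span {x} ≤ Module.annihilator R (QuotSMulTop x (R ⧸ p)) :=
      (Ideal.span_singleton_le_iff_mem _).mpr (QuotSMulTop.mem_annihilator _ x)
    refine subsingleton_ext_of_quotSMulTop (M := of R (R ⧸ p)) hxm hreg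
      (subsingleton_ext_of_quotient_prime (fun q hq hpq => ?_) _
        (sup_le hp_ann hx_ann))
    refine ih q (SetLike.lt_iff_le_and_exists.mpr ⟨le_sup_left.trans hpq, x, ?_, hxp⟩) hq (i + 1)
      (by omega)
    exact hpq (Ideal.mem_sup_right (Ideal.mem_span_singleton_self x))

theorem hasInjectiveDimensionLE_of_subsingleton_ext_residueField {N : ModuleCat.{u} R}
    [Module.Finite R N] {d : ℕ} (h : ∀ i > d, Subsingleton (Ext (of R (ResidueField R)) N i)) :
    HasInjectiveDimensionLE N d :=
  hasInjectiveDimensionLE_of_subsingleton_ext d N fun I =>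
    subsingleton_ext_of_quotient_prime (I := ⊥)
      (fun p hp _ => subsingleton_ext_quotient_prime h p hp (d + 1) (Nat.lt_succ_self d))
      (R ⧸ I) bot_le

end InjectiveDimension

end Ext

section FreeResolution

open Matrix
open ModuleCat (of)

theorem exists_comp_eq_of_exact {R X Y Z W : Type*} [CommRing R] [AddCommGroup X] [Module R X]
    [AddCommGroup Y] [Module R Y] [AddCommGroup Z] [Module R Z] [AddCommGroup W] [Module R W]
    {f : X →ₗ[R] Y} {g : Y →ₗ[R] Z} (hfg : Function.Exact f g) (hg : Function.Surjective g)
    {φ : Y →ₗ[R] W} (hφ : φ ∘ₗ f = 0) : ∃ ψ : Z →ₗ[R] W, ψ ∘ₗ g = φ :=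
  (LinearMap.exact_lcomp_of_exact_of_surjective W hfg hg φ).mp hφ

section Matrix

variable {R : Type*} [CommRing R] {a b c : ℕ}

theorem dotProductEquiv_transpose_mulVec (f : (Fin b → R) →ₗ[R] (Fin a → R)) (u : Fin a → R) :
    dotProductEquiv R (Fin b) ((LinearMap.toMatrix' f)ᵀ *ᵥ u) =
      dotProductEquiv R (Fin a) u ∘ₗ f := by
  refine LinearMap.ext fun x => ?_
  simp only [LinearMap.comp_apply, dotProductEquiv_apply_apply]
  rw [mulVec_transpose, ← dotProduct_mulVec, LinearMap.toMatrix'_mulVec]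

variable {f : (Fin b → R) →ₗ[R] (Fin a → R)} {g : (Fin c → R) →ₗ[R] (Fin b → R)}

theorem exactOn_toMatrix' (h : Function.Exact g f) (I : Ideal R) :
    ExactOn I (LinearMap.toMatrix' g) (LinearMap.toMatrix' f) := by
  intro u _ hu
  obtain ⟨w, hw⟩ := (h u).mp ((LinearMap.toMatrix'_mulVec f u).symm.trans hu)
  exact ⟨w, (LinearMap.toMatrix'_mulVec g w).trans hw⟩

theorem exactOn_transpose_toMatrix'_iff :
    ExactOn ⊤ (LinearMap.toMatrix' f)ᵀ (LinearMap.toMatrix' g)ᵀ ↔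
      ∀ φ : (Fin b → R) →ₗ[R] R, φ ∘ₗ g = 0 → ∃ ψ : (Fin a → R) →ₗ[R] R, ψ ∘ₗ f = φ := by
  simp only [(dotProductEquiv R (Fin _)).surjective.forall,
    (dotProductEquiv R (Fin _)).surjective.exists, ← dotProductEquiv_transpose_mulVec,
    EmbeddingLike.map_eq_zero_iff, EmbeddingLike.apply_eq_iff_eq]
  exact forall_congr' fun u => ⟨fun h => h fun _ => trivial, fun h _ => h⟩

end Matrix

/-- A resolution `⋯ ⟶ R ^ r₁ ⟶ R ^ r₀ ⟶ M ⟶ 0` of an `R`-module `M` by free modules of finite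
rank. -/
structure FiniteFreeResolution (R : Type*) [CommRing R] (M : Type*) [AddCommGroup M]
    [Module R M] where
  rank : ℕ → ℕ
  aug : (Fin (rank 0) → R) →ₗ[R] M
  diff : ∀ n : ℕ, (Fin (rank (n + 1)) → R) →ₗ[R] (Fin (rank n) → R)
  aug_surjective : Function.Surjective aug
  exact_zero : Function.Exact (diff 0) aug
  exact_succ : ∀ n : ℕ, Function.Exact (diff (n + 1)) (diff n)

namespace FiniteFreeResolution

theorem nonempty (R : Type*) [CommRing R] [IsNoetherianRing R] (M : Type*) [AddCommGroup M]
    [Module R M] [Module.Finite R M] : Nonempty (FiniteFreeResolution R M) := by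
  have hcover (K : Σ a : ℕ, Submodule R (Fin a → R)) :
      ∃ (b : ℕ) (g : (Fin b → R) →ₗ[R] (Fin K.1 → R)), LinearMap.range g = K.2 := by
    obtain ⟨b, g, hg⟩ := Module.Finite.exists_fin' R K.2
    exact ⟨b, K.2.subtype ∘ₗ g, by
      rw [LinearMap.range_comp, LinearMap.range_eq_top.mpr hg, Submodule.map_top,
        Submodule.range_subtype]⟩
  choose b g hg using hcover
  obtain ⟨a, aug, haug⟩ := Module.Finite.exists_fin' R M
  let K : ℕ → Σ a : ℕ, Submodule R (Fin a → R) := fun n =>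
    Nat.rec ⟨a, LinearMap.ker aug⟩ (fun _ K => ⟨b K, LinearMap.ker (g K)⟩) n
  exact ⟨{
    rank := fun n => (K n).1
    aug := aug
    diff := fun n => g (K n)
    aug_surjective := haug
    exact_zero := LinearMap.exact_iff.mpr (hg (K 0)).symm
    exact_succ := fun n => LinearMap.exact_iff.mpr (hg (K (n + 1))).symm }⟩

section Basic

variable {R : Type*} [CommRing R] {M : Type*} [AddCommGroup M] [Module R M]
  (G : FiniteFreeResolution R M)

/-- The resolution of the first syzygy module obtained by forgetting the module of degree zero. -/
def truncate : FiniteFreeResolution R (LinearMap.ker G.aug) where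
  rank n := G.rank (n + 1)
  aug := (G.diff 0).codRestrict _ fun x => G.exact_zero.apply_apply_eq_zero x
  diff n := G.diff (n + 1)
  aug_surjective x := by
    obtain ⟨y, hy⟩ := (G.exact_zero x).mp x.2
    exact ⟨y, Subtype.ext hy⟩
  exact_zero x := (Subtype.ext_iff.trans Iff.rfl).trans (G.exact_succ 0 x)
  exact_succ n := G.exact_succ (n + 1)

/-- The matrices of the differentials of the resolution. -/
def matrixComplex : MatrixComplex R G.rank where
  d n := LinearMap.toMatrix' (G.diff n)
  d_mul_d n := by
    rw [← LinearMap.toMatrix'_comp, (G.exact_succ n).linearMap_comp_eq_zero, map_zero]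

/-- The ranks of the free modules in `augmentedComplex`. -/
def augRank : ℕ → ℕ
  | 0 => 0
  | n + 1 => G.rank n

/-- The matrices of the differentials of the complex `⋯ ⟶ R ^ r₁ ⟶ R ^ r₀ ⟶ 0`, in degrees raised
by one. -/
def augmentedComplex : MatrixComplex R G.augRank where
  d
    | 0 => 0
    | n + 1 => G.matrixComplex.d n
  d_mul_d
    | 0 => Matrix.zero_mul _
    | n + 1 => G.matrixComplex.d_mul_d n

theorem exactOn_augmentedComplex {n : ℕ} (hn : 0 < n) (I : Ideal R) :
    ExactOn I (G.augmentedComplex.d (n + 1)) (G.augmentedComplex.d n) := by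
  obtain ⟨n, rfl⟩ := Nat.exists_eq_succ_of_ne_zero hn.ne'
  exact exactOn_toMatrix' (G.exact_succ n) I

end Basic

section Ext

variable {R : Type u} [CommRing R] {M : Type u} [AddCommGroup M] [Module R M]
  (G : FiniteFreeResolution R M)

theorem subsingleton_ext_succ_iff (N : Type u) [AddCommGroup N] [Module R N] (n : ℕ) :
    Subsingleton (Ext (of R M) (of R N) (n + 1)) ↔
      ∀ φ : (Fin (G.rank (n + 1)) → R) →ₗ[R] N, φ ∘ₗ G.diff (n + 1) = 0 →
        ∃ ψ : (Fin (G.rank n) → R) →ₗ[R] N, ψ ∘ₗ G.diff n = φ := by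
  have hS := LinearMap.shortExact_shortComplexKer G.aug_surjective
  have : Projective G.aug.shortComplexKer.X₂ :=
    (IsProjective.iff_projective (Fin (G.rank 0) → R)).mp inferInstance
  induction n generalizing M with
  | zero =>
    refine (subsingleton_ext_one_iff hS _).trans ⟨fun h φ hφ => ?_, fun h φ => ?_⟩
    · obtain ⟨θ, rfl⟩ := exists_comp_eq_of_exact G.truncate.exact_zero G.truncate.aug_surjective hφ
      obtain ⟨ψ, hψ⟩ := h (ModuleCat.ofHom θ)
      exact ⟨ψ.hom, congrArg (fun χ => χ.hom ∘ₗ G.truncate.aug) hψ⟩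
    · obtain ⟨ψ, hψ⟩ := h (φ.hom ∘ₗ G.truncate.aug) <| LinearMap.ext fun x =>
        (congrArg φ.hom (G.truncate.exact_zero.apply_apply_eq_zero x)).trans (map_zero φ.hom)
      exact ⟨ModuleCat.ofHom ψ, ModuleCat.hom_ext <|
        (LinearMap.cancel_right G.truncate.aug_surjective).mp hψ⟩
  | succ n ih =>
    exact (subsingleton_ext_X₃_iff hS (of R N) n).trans (ih G.truncate
      (LinearMap.shortExact_shortComplexKer G.truncate.aug_surjective)
      ((IsProjective.iff_projective (Fin (G.truncate.rank 0) → R)).mp inferInstance))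

theorem subsingleton_ext_succ_iff_exactOn (n : ℕ) :
    Subsingleton (Ext (of R M) (of R R) (n + 1)) ↔
      ExactOn ⊤ (G.matrixComplex.d n)ᵀ (G.matrixComplex.d (n + 1))ᵀ :=
  (G.subsingleton_ext_succ_iff R n).trans exactOn_transpose_toMatrix'_iff.symm

theorem eq_zero_of_transpose_mulVec_eq_zero [Subsingleton (M →ₗ[R] R)]
    {u : Fin (G.rank 0) → R} (hu : (G.matrixComplex.d 0)ᵀ *ᵥ u = 0) : u = 0 := by
  obtain ⟨χ, hχ⟩ := exists_comp_eq_of_exact G.exact_zero G.aug_surjective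
    (φ := dotProductEquiv R _ u)
    ((dotProductEquiv_transpose_mulVec (G.diff 0) u).symm.trans
      ((dotProductEquiv R _).map_eq_zero_iff.mpr hu))
  refine (dotProductEquiv R _).map_eq_zero_iff.mp ?_
  rw [← hχ, Subsingleton.elim χ 0, LinearMap.zero_comp]

theorem exactOn_transpose_augmentedComplex :
    ∀ {n : ℕ}, Subsingleton (Ext (of R M) (of R R) n) →
      ExactOn ⊤ (G.augmentedComplex.d n)ᵀ (G.augmentedComplex.d (n + 1))ᵀ
  | 0, h => fun u _ hu => by
    have : Subsingleton (M →ₗ[R] R) :=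
      ((Ext.homEquiv₀ (X := of R M) (Y := of R R)).trans ModuleCat.homEquiv).symm.subsingleton
    exact ⟨0, (mulVec_zero _).trans (G.eq_zero_of_transpose_mulVec_eq_zero hu).symm⟩
  | n + 1, h => (G.subsingleton_ext_succ_iff_exactOn n).mp h

end Ext

end FiniteFreeResolution

end FreeResolution

section LocalRing

open Matrix
open ModuleCat (of)

section NonminimalMap

variable {R : Type*} [CommRing R] [IsLocalRing R] {L : Type*} [AddCommGroup L] [Module R L]

theorem exists_linearMap_residueField_ne_zero {x : L}
    (hx : x ∉ maximalIdeal R • (⊤ : Submodule R L)) :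
    ∃ φ : L →ₗ[R] ResidueField R, φ x ≠ 0 := by
  have hne : (maximalIdeal R • (⊤ : Submodule R L)).mkQ x ≠ 0 := by
    rwa [Ne, Submodule.mkQ_apply, Submodule.Quotient.mk_eq_zero]
  let := Ideal.Quotient.field (maximalIdeal R)
  obtain ⟨φ, hφ⟩ := Module.Projective.exists_dual_ne_zero (R ⧸ maximalIdeal R) hne
  exact ⟨φ.restrictScalars R ∘ₗ Submodule.mkQ _, hφ⟩

theorem exists_linearMap_eq_one {a : ℕ} {p : (Fin a → R) →ₗ[R] L} {v : Fin a → R}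
    (hv : p v ∉ maximalIdeal R • (⊤ : Submodule R L)) :
    ∃ γ : (Fin a → R) →ₗ[R] R, γ v = 1 ∧ ∀ w, p w = 0 → γ w ∈ maximalIdeal R := by
  obtain ⟨φ, hφ⟩ := exists_linearMap_residueField_ne_zero hv
  obtain ⟨γ, hγ⟩ := Module.projective_lifting_property (Algebra.linearMap R (ResidueField R))
    (φ ∘ₗ p) residue_surjective
  have hres (w : Fin a → R) : residue R (γ w) = φ (p w) := LinearMap.congr_fun hγ w
  have hunit : IsUnit (γ v) := by rwa [← residue_ne_zero_iff_isUnit, hres]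
  obtain ⟨b, hb⟩ := hunit.exists_left_inv
  refine ⟨b • γ, hb, fun w hw => Ideal.mul_mem_left _ b ?_⟩
  rw [← residue_eq_zero_iff, hres, hw, map_zero]

theorem hasNonminimalMap_of_not_range_le (G : FiniteFreeResolution R L) {p q : ℕ}
    {δ : (Fin p → R) →ₗ[R] (Fin q → R)} {α : (Fin q → R) →ₗ[R] L} (hα : α ∘ₗ δ = 0)
    (hrange : ¬ LinearMap.range α ≤ maximalIdeal R • ⊤) :
    HasNonminimalMap (LinearMap.toMatrix' δ) (G.matrixComplex.d 0) := by
  obtain ⟨_, ⟨v, rfl⟩, hv⟩ := SetLike.not_le_iff_exists.mp hrange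
  obtain ⟨F, rfl⟩ := Module.projective_lifting_property G.aug α G.aug_surjective
  obtain ⟨E, hE⟩ : ∃ E : (Fin p → R) →ₗ[R] (Fin (G.rank 1) → R), G.truncate.aug ∘ₗ E =
      (F ∘ₗ δ).codRestrict (LinearMap.ker G.aug) (LinearMap.congr_fun hα) :=
    Module.projective_lifting_property _ _ G.truncate.aug_surjective
  have hFE : F ∘ₗ δ = G.diff 0 ∘ₗ E :=
    LinearMap.ext fun x => congrArg Subtype.val (LinearMap.congr_fun hE x).symm
  obtain ⟨γ, hγv, hγ⟩ := exists_linearMap_eq_one (p := G.aug) (v := F v) hv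
  obtain ⟨g, rfl⟩ := (dotProductEquiv R _).surjective γ
  refine ⟨LinearMap.toMatrix' F, LinearMap.toMatrix' E, v, g, ?_, ?_, fun i => ?_⟩
  · rw [← LinearMap.toMatrix'_comp, hFE, LinearMap.toMatrix'_comp]
    rfl
  · rwa [LinearMap.toMatrix'_mulVec]
  · have hcol : g ⬝ᵥ (G.diff 0) (Pi.single i 1) ∈ maximalIdeal R :=
      hγ _ (G.exact_zero.apply_apply_eq_zero _)
    rwa [← LinearMap.toMatrix'_mulVec, dotProduct_mulVec, dotProduct_single_one] at hcol

theorem exists_not_range_comp_lof_le [Nontrivial L] [Module.Finite R L] {ι : Type*}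
    [DecidableEq ι] {M : ι → Type*} [∀ i, AddCommGroup (M i)] [∀ i, Module R (M i)]
    {f : DirectSum ι M →ₗ[R] L} (hf : Function.Surjective f) :
    ∃ i, ¬ LinearMap.range (f ∘ₗ DirectSum.lof R ι M i) ≤ maximalIdeal R • ⊤ := by
  by_contra! h
  have hrange : LinearMap.range f ≤ maximalIdeal R • ⊤ := by
    rintro _ ⟨x, rfl⟩
    induction x using DirectSum.induction_on with
    | zero => rw [map_zero]; exact zero_mem _
    | of i x => exact h i ⟨x, rfl⟩
    | add x y hx hy => rw [map_add]; exact add_mem hx hy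
  rw [LinearMap.range_eq_top.mpr hf] at hrange
  exact top_ne_bot (Submodule.eq_bot_of_le_smul_of_le_jacobson_bot _ _ Module.Finite.fg_top hrange
    (maximalIdeal_le_jacobson _))

end NonminimalMap

theorem IsCohenMacaulayLocal.subsingleton_ext_residueField {R : Type u} [CommRing R]
    [IsLocalRing R] [IsNoetherianRing R] (h : IsCohenMacaulayLocal R) {d : ℕ}
    (hd : ringKrullDim R = d) {i : ℕ} (hi : i < d) :
    Subsingleton (Ext (of R (ResidueField R)) (of R R) i) := by
  have hdepth : localRingDepth R = d := WithBot.coe_injective (h.trans hd)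
  have hlt : (i : ℕ∞) < localRingDepth R := hdepth ▸ Nat.cast_lt.mpr hi
  obtain ⟨⟨rs, hrs, hreg⟩, hlt⟩ := lt_iSup_iff.mp hlt
  refine ModuleCat.subsingleton_ext_of_exists_isRegular (maximalIdeal R)
    (of R (ResidueField R)) ?_ (of R R) ?_ rs hrs hreg i (Nat.cast_lt.mp hlt)
  · rw [Module.support_eq_zeroLocus]
    exact PrimeSpectrum.zeroLocus_anti_mono (Ideal.annihilator_quotient (I := maximalIdeal R)).ge
  · simpa [lt_top_iff_ne_top] using (maximalIdeal.isMaximal R).ne_top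

namespace MinimalFreeResolution

variable {R : Type u} [CommRing R] [IsLocalRing R]

section Syzygy

variable {M : Type u} [AddCommGroup M] [Module R M] (F : MinimalFreeResolution R M)

/-- The minimal resolution `F` with its minimality forgotten. -/
def toFiniteFreeResolution : FiniteFreeResolution R M :=
  { F with }

/-- The projection of a free module of the resolution onto the syzygy module of its degree. -/
noncomputable def syzygyCover : ∀ n, (Fin (F.rank n) → R) →ₗ[R] F.syzygy n
  | 0 => F.aug.rangeRestrict
  | n + 1 => (F.diff n).rangeRestrict

theorem syzygyCover_surjective : ∀ n, Function.Surjective (F.syzygyCover n)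
  | 0 => F.aug.surjective_rangeRestrict
  | n + 1 => (F.diff n).surjective_rangeRestrict

theorem syzygyCover_comp_diff : ∀ n, F.syzygyCover n ∘ₗ F.diff n = 0
  | 0 => LinearMap.ext fun x => Subtype.ext (F.exact_zero.apply_apply_eq_zero x)
  | n + 1 => LinearMap.ext fun x => Subtype.ext ((F.exact_succ n).apply_apply_eq_zero x)

instance finite_syzygy (n : ℕ) : Module.Finite R (F.syzygy n) :=
  Module.Finite.of_surjective _ (F.syzygyCover_surjective n)

theorem augmentedComplex_mem_maximalIdeal :
    ∀ n i j, F.toFiniteFreeResolution.augmentedComplex.d n i j ∈ maximalIdeal R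
  | 0, _, _ => zero_mem _
  | n + 1, i, j => by
    rw [show F.toFiniteFreeResolution.augmentedComplex.d (n + 1) i j =
      F.diff n (Pi.single j 1) i from LinearMap.toMatrix'_apply (F.diff n) i j]
    exact mem_smul_top_pi_iff.mp (F.minimal n ⟨_, rfl⟩) i

end Syzygy

variable (F : MinimalFreeResolution R (ResidueField R))

theorem rank_zero_pos : 0 < F.rank 0 := by
  refine Nat.pos_of_ne_zero fun h => ?_
  have : IsEmpty (Fin (F.rank 0)) := by rw [h]; infer_instance
  have := F.aug_surjective.subsingleton
  exact one_ne_zero (Subsingleton.elim (1 : ResidueField R) 0)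

theorem exactOn_maximalIdeal_augmentedComplex :
    ∀ n, ExactOn (maximalIdeal R) (F.toFiniteFreeResolution.augmentedComplex.d (n + 1))
      (F.toFiniteFreeResolution.augmentedComplex.d n)
  | 0 => fun u hu _ => by
    have haug : F.aug u = 0 := by
      rw [F.aug.pi_apply_eq_sum_univ u]
      refine Finset.sum_eq_zero fun i _ => ?_
      rw [Algebra.smul_def, ResidueField.algebraMap_eq, (residue_eq_zero_iff _).mpr (hu i),
        zero_mul]
    obtain ⟨w, hw⟩ := (F.exact_zero u).mp haug
    exact ⟨w, (LinearMap.toMatrix'_mulVec (F.diff 0) w).trans hw⟩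
  | n + 1 => F.toFiniteFreeResolution.exactOn_augmentedComplex n.succ_pos _

theorem isAdapted [IsNoetherianRing R] (hCM : IsCohenMacaulayLocal R) {d : ℕ}
    (hd : ringKrullDim R = d) {L : Type u} [AddCommGroup L] [Module R L]
    (hL : ∀ i ≤ d, Subsingleton (Ext (of R L) (of R R) (i + 1))) (G : FiniteFreeResolution R L) :
    IsAdapted F.toFiniteFreeResolution.augmentedComplex G.matrixComplex d d where
  mem_maximalIdeal := F.augmentedComplex_mem_maximalIdeal
  exactOn_maximalIdeal := F.exactOn_maximalIdeal_augmentedComplex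
  exactOn_top n hn := F.toFiniteFreeResolution.exactOn_augmentedComplex (by omega) ⊤
  exactOn_transpose n hn := F.toFiniteFreeResolution.exactOn_transpose_augmentedComplex
    (hCM.subsingleton_ext_residueField hd hn)
  exactOn_transpose_cover n hn := (G.subsingleton_ext_succ_iff_exactOn n).mp (hL n hn)

end MinimalFreeResolution

end LocalRing

theorem corollary5p3_general {R : Type u} [CommRing R] [IsLocalRing R] [IsNoetherianRing R]
    (hCM : IsCohenMacaulayLocal R) (hmult : HasMinimalMultiplicity R)
    (F : MinimalFreeResolution R (ResidueField R)) {m : ℕ}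
    {L : Type u} [AddCommGroup L] [Module R L] [Module.Finite R L]
    (hL : ∀ i : ℕ, 1 ≤ i → (i : WithBot ℕ∞) ≤ ringKrullDim R + 1 →
      Subsingleton (Ext.{u} (ModuleCat.of R L) (ModuleCat.of R R) i))
    (f : F.syzygy m →ₗ[R] L) (hf : ¬ LinearMap.range f ≤ maximalIdeal R • ⊤) :
    IsGorensteinLocal R := by
  obtain ⟨d, hd, -⟩ := id hmult
  obtain ⟨G⟩ := FiniteFreeResolution.nonempty R L
  have hadapted := F.isAdapted hCM hd (fun i hi => hL (i + 1) (Nat.le_add_left 1 i) <| by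
    rw [hd]; exact_mod_cast Nat.succ_le_succ hi) G
  have hmap : HasNonminimalMap (LinearMap.toMatrix' (F.diff m)) (G.matrixComplex.d 0) := by
    refine hasNonminimalMap_of_not_range_le G (α := f ∘ₗ F.syzygyCover m) ?_ ?_
    · rw [LinearMap.comp_assoc, F.syzygyCover_comp_diff, LinearMap.comp_zero]
    · rwa [LinearMap.range_comp_of_range_eq_top _
        (LinearMap.range_eq_top.mpr (F.syzygyCover_surjective m))]
  refine ⟨d, hasInjectiveDimensionLE_of_subsingleton_ext_residueField fun i hi => ?_⟩
  obtain ⟨i, rfl⟩ := Nat.exists_eq_succ_of_ne_zero (Nat.ne_zero_of_lt hi)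
  exact (F.toFiniteFreeResolution.subsingleton_ext_succ_iff_exactOn i).mpr <|
    hadapted.exactOn_transpose_of_hasMinimalMultiplicity hmult hd rfl F.rank_zero_pos hmap hi

theorem corollary5p3 {R : Type u} [CommRing R] [IsLocalRing R] [IsNoetherianRing R]
    (hCM : IsCohenMacaulayLocal R) (hmult : HasMinimalMultiplicity R)
    (F : MinimalFreeResolution R (IsLocalRing.ResidueField R))
    {r : ℕ} (n : Fin r → ℕ)
    {L : Type u} [AddCommGroup L] [Module R L] [Nontrivial L] (hL : IsGDimZero R L)
    (f : DirectSum (Fin r) (fun i => F.syzygy (n i)) →ₗ[R] L) (hf : Function.Surjective f) :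
    IsGorensteinLocal R := by
  have := Module.Finite.of_surjective f hf
  obtain ⟨i, hi⟩ := exists_not_range_comp_lof_le hf
  exact corollary5p3_general hCM hmult F (fun j hj _ => hL.ext_eq_zero j hj) _ hi
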